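/- All vector spaces are over $\mathbb C$, and modules over Lie superalgebras are $\mathbb Z/2$-graded (a submodule is a graded subspace stable under the action, and isomorphisms preserve parity). Let $\mathcal S$ be the Fermion-Virasoro algebra: the Lie superalgebra with even basis vectors $L_m$ $(m\in\mathbb Z)$, $c$, $z$, odd basis vectors $\psi_n$ $(n\in\mathbb Z)$, and brackets $$[L_m,L_n]=(m-n)L_{m+n}+\delta_{m,-n}\tfrac{m^3-m}{12}c,\quad [L_m,\psi_n]=\left(-n-\tfrac m2\right)\psi_{m+n},\quad [\psi_m,\psi_n]=\delta_{m,-n}z,$$ with $c,z$ central. It is $\mathbb Z$-graded by $\deg L_k=\deg\psi_k=k$, $\deg c=\deg z=0$; let $\mathrm{Vir}=\mathrm{span}\{L_m,c\}$ and $F=\mathrm{span}\{\psi_n,z\}$. A module $M$ over a $\mathbb Z$-graded Lie (super)algebra $\mathfrak g=\bigoplus_i\mathfrak g_i$ is smooth if for every $v\in M$ there is $n\ge 0$ with $\mathfrak g_iv=0$ for all $i>n$. An $\mathcal S$-module has level $\lambda$ if $z$ acts as the scalar $\lambda$. Let $\mathscr V$ be the exterior algebra on odd generators $\xi_0,\xi_1,\xi_2,\dots$,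 with operators $$\psi_n=\partial/\partial\xi_n,\quad \psi_{-n}=\xi_n\ (n\ge1),\quad \psi_0=\tfrac1{\sqrt2}\left(\xi_0+\partial/\partial\xi_0\right),\quad \bar L_k=\tfrac1{16}\delta_{k,0}+\tfrac12\sum_{j\in\mathbb Z}j:\psi_{-j}\psi_{j+k}:,$$ where $:\psi_j\psi_k:$ is $\psi_j\psi_k$ if $k\ge j$ and $-\psi_k\psi_j$ if $k<j$. For $\mu\in\mathbb C^*$ let $\mathscr V^{\mu}$ be $\mathscr V$ with $\psi_n$ acting as $\mu\psi_n$, $z$ as $\mu^2$, $L_k$ as $\bar L_k$ and $c$ as $\tfrac12$. For a $\mathrm{Vir}$-module $V$ let $V^{\mathcal S}$ be the $\mathcal S$-module $V$, placed in even parity, on which $F$ acts by zero. Theorem. Let $M$ be a simple smooth $\mathcal S$-module of level $\lambda\in\mathbb C^*$. Then there are a simple smooth $\mathrm{Vir}$-module $V$ and a complex number $\sqrt\lambda$ with $(\sqrt\lambda)^2=\lambda$ such that $\mathscr V^{\sqrt\lambda}$ is an $\mathcal S$-module and $M\cong\mathscr V^{\sqrt\lambda}\otimes V^{\mathcal S}$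 as $\mathcal S$-modules. -/

import Mathlib

open scoped TensorProduct

universe u

noncomputable section

/-! ## Super vector spaces, Lie superalgebras and their modules

All vector spaces are over `ℂ`. -/

theorem parity_cases (i : ZMod 2) : i = 0 ∨ i = 1 := by
  revert i
  decide

/-- A super vector space, that is a `ℤ/2`-graded space `V = V₀ ⊕ V₁`. The grading is recorded by
its parity involution, which is `1` on the even part `V₀` and `-1` on the odd part `V₁`. -/
class SuperSpace (V : Type*) [AddCommGroup V] [Module ℂ V] where
  parity : V →ₗ[ℂ] V
  parity_parity : ∀ v, parity (parity v) = v

namespace SuperSpace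

variable (V : Type*) [AddCommGroup V] [Module ℂ V] [SuperSpace V]

/-- The homogeneous component of parity `i`: the vectors `v` with `parity v = (-1)^i v`. -/
def part (i : ZMod 2) : Submodule ℂ V :=
  Module.End.eigenspace (parity : V →ₗ[ℂ] V) ((-1) ^ i.val)

/-- The projection onto the component of parity `i`. -/
def proj (i : ZMod 2) : V →ₗ[ℂ] V :=
  (1 / 2 : ℂ) • (LinearMap.id + ((-1 : ℂ) ^ i.val) • parity)

variable {V}

theorem mem_part {i : ZMod 2} {v : V} : v ∈ part V i ↔ parity v = ((-1 : ℂ) ^ i.val) • v :=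
  Module.End.mem_eigenspace_iff

/-- A super vector space is the direct sum of its even and its odd part. -/
theorem isCompl_part : IsCompl (part V 0) (part V 1) := by
  constructor
  · rw [Submodule.disjoint_def]
    intro v h0 h1
    rw [mem_part] at h0 h1
    rw [h0] at h1
    have h2 : (2 : ℂ) • v = 0 := by
      have h3 : v = -v := by simpa [ZMod.val_one] using h1
      rw [two_smul]
      nth_rewrite 1 [h3]
      simp
    exact (smul_eq_zero.1 h2).resolve_left two_ne_zero
  · rw [codisjoint_iff, eq_top_iff]
    intro v _
    refine Submodule.mem_sup.2 ⟨proj V 0 v, ?_, proj V 1 v, ?_, ?_⟩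
    · rw [mem_part]
      simp [proj, parity_parity, add_comm]
    · rw [mem_part]
      simp only [proj, ZMod.val_one, LinearMap.smul_apply, LinearMap.add_apply, LinearMap.id_apply,
        map_smul, map_add, parity_parity]
      module
    · simp only [proj, ZMod.val_zero, ZMod.val_one, LinearMap.smul_apply, LinearMap.add_apply,
        LinearMap.id_apply]
      module

end SuperSpace

open SuperSpace

/-- A Lie superalgebra over `ℂ`. -/
class LieSuperalgebra (g : Type*) [AddCommGroup g] [Module ℂ g] [SuperSpace g] where
  sbracket : g →ₗ[ℂ] g →ₗ[ℂ] g
  sbracket_mem : ∀ (i j : ZMod 2) (x y : g), x ∈ part g i → y ∈ part g j →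
    sbracket x y ∈ part g (i + j)
  sbracket_skew : ∀ (i j : ZMod 2) (x y : g), x ∈ part g i → y ∈ part g j →
    sbracket x y = -((-1 : ℂ) ^ (i.val * j.val) • sbracket y x)
  sbracket_jacobi : ∀ (i j : ZMod 2) (x y w : g), x ∈ part g i → y ∈ part g j →
    sbracket x (sbracket y w) =
      sbracket (sbracket x y) w + (-1 : ℂ) ^ (i.val * j.val) • sbracket y (sbracket x w)

open LieSuperalgebra

section Modules

variable {g : Type*} [AddCommGroup g] [Module ℂ g]
variable {M : Type*} [AddCommGroup M] [Module ℂ M]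
variable {N : Type*} [AddCommGroup N] [Module ℂ N]

/-- The linear action `ρ` makes the super vector space `M` a module over the Lie
superalgebra `g`. -/
structure IsSuperModule [SuperSpace g] [LieSuperalgebra g] [SuperSpace M]
    (ρ : g →ₗ[ℂ] Module.End ℂ M) : Prop where
  act_mem : ∀ (i j : ZMod 2) (x : g) (v : M), x ∈ part g i → v ∈ part M j →
    ρ x v ∈ part M (i + j)
  act_sbracket : ∀ (i j : ZMod 2) (x y : g), x ∈ part g i → y ∈ part g j → ∀ v : M,
    ρ (sbracket x y) v = ρ x (ρ y v) - (-1 : ℂ) ^ (i.val * j.val) • ρ y (ρ x v)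

/-- The super module `M` is simple: it is nonzero and has no graded submodules besides `0`
and `M`. (A subspace is graded if and only if it is stable under the parity involution.) -/
structure IsSimpleSuperModule [SuperSpace M] (ρ : g →ₗ[ℂ] Module.End ℂ M) : Prop where
  nontrivial : Nontrivial M
  eq_bot_or_eq_top : ∀ W : Submodule ℂ M, (∀ v ∈ W, parity v ∈ W) →
    (∀ (x : g), ∀ v ∈ W, ρ x v ∈ W) → W = ⊥ ∨ W = ⊤

/-- The module `M` over the `ℤ`-graded algebra `g = ⨁ gr i` is smooth: every vector is killed by
all `gr i` with `i` large. -/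
def IsSmooth (gr : ℤ → Submodule ℂ g) (ρ : g →ₗ[ℂ] Module.End ℂ M) : Prop :=
  ∀ v : M, ∃ n : ℕ, ∀ i : ℤ, (n : ℤ) < i → ∀ x ∈ gr i, ρ x v = 0

/-- Two super modules are isomorphic: there is a parity preserving linear equivalence which
intertwines the actions. -/
def SuperIso [SuperSpace M] [SuperSpace N] (ρ : g →ₗ[ℂ] Module.End ℂ M)
    (τ : g →ₗ[ℂ] Module.End ℂ N) : Prop :=
  ∃ e : M ≃ₗ[ℂ] N, (∀ v, e (parity v) = parity (e v)) ∧ ∀ x v, e (ρ x v) = τ x (e v)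

/-- The tensor product of super vector spaces, with `|v ⊗ w| = |v| + |w|`. -/
instance [SuperSpace M] [SuperSpace N] : SuperSpace (M ⊗[ℂ] N) where
  parity := TensorProduct.map parity parity
  parity_parity t := by
    induction t with
    | zero => simp
    | tmul v w => simp [parity_parity]
    | add s t hs ht => rw [map_add, map_add, hs, ht]

/-- The tensor product of two actions: `x (v ⊗ w) = x v ⊗ w + (-1)^{|x||v|} v ⊗ x w`
(see `tensorAct_tmul`). -/
def tensorAct [SuperSpace g] [SuperSpace M] (ρ : g →ₗ[ℂ] Module.End ℂ M)
    (τ : g →ₗ[ℂ] Module.End ℂ N) : g →ₗ[ℂ] Module.End ℂ (M ⊗[ℂ] N) :=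
  LinearMap.rTensorHom N ∘ₗ ρ + LinearMap.lTensorHom M ∘ₗ τ ∘ₗ proj g 0 +
    TensorProduct.mapBilinear (RingHom.id ℂ) M N M N parity ∘ₗ τ ∘ₗ proj g 1

theorem tensorAct_tmul [SuperSpace g] [SuperSpace M] (ρ : g →ₗ[ℂ] Module.End ℂ M)
    (τ : g →ₗ[ℂ] Module.End ℂ N) (i j : ZMod 2) (x : g) (v : M) (w : N)
    (hx : x ∈ part g i) (hv : v ∈ part M j) :
    tensorAct ρ τ x (v ⊗ₜ w) = ρ x v ⊗ₜ w + (-1 : ℂ) ^ (i.val * j.val) • v ⊗ₜ τ x w := by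
  rw [mem_part] at hx hv
  rcases parity_cases i with rfl | rfl
  · rw [ZMod.val_zero, pow_zero, one_smul] at hx
    have h0 : proj g 0 x = x := by
      simp only [proj, ZMod.val_zero, LinearMap.smul_apply, LinearMap.add_apply,
        LinearMap.id_apply, hx]
      module
    have h1 : proj g 1 x = 0 := by
      simp only [proj, ZMod.val_one, LinearMap.smul_apply, LinearMap.add_apply,
        LinearMap.id_apply, hx]
      module
    simp [tensorAct, h0, h1]
  · rw [ZMod.val_one, pow_one, neg_one_smul] at hx
    have h0 : proj g 0 x = 0 := by
      simp only [proj, ZMod.val_zero, LinearMap.smul_apply, LinearMap.add_apply,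
        LinearMap.id_apply, hx]
      module
    have h1 : proj g 1 x = x := by
      simp only [proj, ZMod.val_one, LinearMap.smul_apply, LinearMap.add_apply,
        LinearMap.id_apply, hx]
      module
    simp [tensorAct, h0, h1, hv, ZMod.val_one, TensorProduct.smul_tmul']

end Modules

/-- An ordinary vector space `V`, regarded as a purely even super vector space. -/
def PureEven (V : Type*) : Type _ := V

instance (V : Type*) [AddCommGroup V] : AddCommGroup (PureEven V) := inferInstanceAs (AddCommGroup V)

instance (V : Type*) [AddCommGroup V] [Module ℂ V] : Module ℂ (PureEven V) :=
  inferInstanceAs (Module ℂ V)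

instance (V : Type*) [AddCommGroup V] [Module ℂ V] : SuperSpace (PureEven V) where
  parity := LinearMap.id
  parity_parity _ := rfl

/-! ## The Virasoro algebra -/

/-- The basis `L_m` (`m ∈ ℤ`), `c` of the Virasoro algebra. -/
inductive VirIndex : Type
  | L (m : ℤ)
  | c

/-- The underlying vector space of the Virasoro algebra. -/
def Vir : Type := VirIndex →₀ ℂ

namespace Vir

instance : AddCommGroup Vir := inferInstanceAs (AddCommGroup (VirIndex →₀ ℂ))

instance : Module ℂ Vir := inferInstanceAs (Module ℂ (VirIndex →₀ ℂ))

/-- The basis of the Virasoro algebra. -/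
def basis : Module.Basis VirIndex ℂ Vir := Finsupp.basisSingleOne

/-- The brackets of basis vectors. -/
def bracketBasis : VirIndex → VirIndex → Vir
  | .L m, .L n => ((m : ℂ) - n) • basis (.L (m + n)) +
      (if m + n = 0 then ((m : ℂ) ^ 3 - m) / 12 else 0) • basis .c
  | .L _, .c => 0
  | .c, .L _ => 0
  | .c, .c => 0

/-- The bilinear extension of the brackets of basis vectors. -/
def bracket : Vir →ₗ[ℂ] Vir →ₗ[ℂ] Vir :=
  basis.constr ℂ fun a => basis.constr ℂ fun b => bracketBasis a b

@[simp]
theorem bracket_basis (a b : VirIndex) : bracket (basis a) (basis b) = bracketBasis a b := by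
  simp [bracket]

theorem bracket_flip : bracket.flip = -bracket := by
  refine basis.ext fun a => basis.ext fun b => ?_
  rcases a with m | _ <;> rcases b with n | _ <;>
    simp only [LinearMap.flip_apply, LinearMap.neg_apply, bracket_basis, bracketBasis, neg_zero]
  by_cases h : m + n = 0
  · obtain rfl : n = -m := by omega
    simp only [neg_add_cancel, add_neg_cancel, if_true]
    push_cast
    module
  · have h' : n + m ≠ 0 := by omega
    rw [if_neg h, if_neg h', add_comm n m]
    module

theorem bracket_jacobi (x y w : Vir) : bracket x (bracket y w) =
    bracket (bracket x y) w + bracket y (bracket x w) := by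
  have key : ∀ a b d : VirIndex, bracket (basis a) (bracket (basis b) (basis d)) =
      bracket (bracket (basis a) (basis b)) (basis d) +
        bracket (basis b) (bracket (basis a) (basis d)) := by
    intro a b d
    rcases a with m | _ <;> rcases b with n | _ <;> rcases d with k | _ <;>
      simp only [bracket_basis, bracketBasis, map_add, map_smul, map_zero, LinearMap.zero_apply,
        LinearMap.add_apply, LinearMap.smul_apply, smul_zero, add_zero]
    rw [show n + (m + k) = m + (n + k) by ring, show m + n + k = m + (n + k) by ring]
    by_cases h : m + (n + k) = 0
    · obtain rfl : k = -m - n := by omega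
      simp only [h, if_true]
      push_cast
      module
    · simp only [h, if_false]
      push_cast
      module
  have h1 : ∀ a b, bracket (basis a) (bracket (basis b) w) =
      bracket (bracket (basis a) (basis b)) w + bracket (basis b) (bracket (basis a) w) := by
    intro a b
    have h : bracket (basis a) ∘ₗ bracket (basis b) = bracket (bracket (basis a) (basis b)) +
        bracket (basis b) ∘ₗ bracket (basis a) := basis.ext fun d => key a b d
    exact LinearMap.congr_fun h w
  have h2 : ∀ a, bracket (basis a) (bracket y w) =
      bracket (bracket (basis a) y) w + bracket y (bracket (basis a) w) := by
    intro a
    have h : bracket (basis a) ∘ₗ bracket.flip w = bracket.flip w ∘ₗ bracket (basis a) +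
        bracket.flip (bracket (basis a) w) := basis.ext fun b => h1 a b
    exact LinearMap.congr_fun h y
  have h : bracket.flip (bracket y w) = bracket.flip w ∘ₗ bracket.flip y +
      bracket y ∘ₗ bracket.flip w := basis.ext fun a => h2 a
  exact LinearMap.congr_fun h x

instance : LieRing Vir where
  bracket x y := bracket x y
  add_lie x y w := by simp
  lie_add x y w := by simp
  lie_self x := by
    have h : bracket x x = -bracket x x := LinearMap.congr_fun₂ bracket_flip x x
    have h2 : (2 : ℂ) • bracket x x = 0 := by
      rw [two_smul]
      nth_rewrite 1 [h]
      simp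
    exact (smul_eq_zero.1 h2).resolve_left two_ne_zero
  leibniz_lie x y w := bracket_jacobi x y w

instance : LieAlgebra ℂ Vir where
  lie_smul t x y := (bracket x).map_smul t y

/-- The degree of a basis vector. -/
def degree : VirIndex → ℤ
  | .L m => m
  | .c => 0

/-- The homogeneous component of degree `k` of the Virasoro algebra. -/
def component (k : ℤ) : Submodule ℂ Vir :=
  Submodule.span ℂ (basis '' {a | degree a = k})

end Vir

/-! ## The Fermion-Virasoro algebra -/

/-- The basis `L_m`, `ψ_n` (`m, n ∈ ℤ`), `c`, `z` of the Fermion-Virasoro algebra. -/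
inductive FVIndex : Type
  | L (m : ℤ)
  | ψ (n : ℤ)
  | c
  | z

/-- The underlying vector space of the Fermion-Virasoro algebra `S = S(0)`. -/
def FermionVirasoro : Type := FVIndex →₀ ℂ

namespace FermionVirasoro

instance : AddCommGroup FermionVirasoro := inferInstanceAs (AddCommGroup (FVIndex →₀ ℂ))

instance : Module ℂ FermionVirasoro := inferInstanceAs (Module ℂ (FVIndex →₀ ℂ))

/-- The basis of the Fermion-Virasoro algebra. -/
def basis : Module.Basis FVIndex ℂ FermionVirasoro := Finsupp.basisSingleOne

/-- The `ψ_n` are odd, the other basis vectors are even. -/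
def indexParity : FVIndex → ZMod 2
  | .ψ _ => 1
  | _ => 0

instance : SuperSpace FermionVirasoro where
  parity := basis.constr ℂ fun a => (-1 : ℂ) ^ (indexParity a).val • basis a
  parity_parity x := by
    have h : (basis.constr ℂ fun a => (-1 : ℂ) ^ (indexParity a).val • basis a) ∘ₗ
        (basis.constr ℂ fun a => (-1 : ℂ) ^ (indexParity a).val • basis a) =
        (LinearMap.id : FermionVirasoro →ₗ[ℂ] FermionVirasoro) := by
      refine basis.ext fun a => ?_
      simp [smul_smul, ← mul_pow]
    exact LinearMap.congr_fun h x

theorem parity_basis (a : FVIndex) :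
    parity (basis a) = (-1 : ℂ) ^ (indexParity a).val • basis a := by
  simp [parity]

theorem part_eq_span (i : ZMod 2) :
    part FermionVirasoro i = Submodule.span ℂ (basis '' {a | indexParity a = i}) := by
  apply le_antisymm
  · intro x hx
    rw [mem_part] at hx
    rw [basis.mem_span_image]
    intro a ha
    have ha' : basis.repr x a ≠ 0 := by simpa using ha
    have h1 : basis.coord a ∘ₗ parity = (-1 : ℂ) ^ (indexParity a).val • basis.coord a := by
      refine basis.ext fun b => ?_
      by_cases hab : b = a
      · subst hab
        simp [parity_basis]
      · simp [parity_basis, hab]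
    have h2 := LinearMap.congr_fun h1 x
    simp only [LinearMap.comp_apply, hx, map_smul, LinearMap.smul_apply, Module.Basis.coord_apply,
      smul_eq_mul] at h2
    have h3 := mul_right_cancel₀ ha' h2
    change indexParity a = i
    generalize indexParity a = j at h3
    rcases parity_cases i with rfl | rfl <;> rcases parity_cases j with rfl | rfl <;>
      first | rfl | norm_num [ZMod.val_one] at h3
  · rw [Submodule.span_le]
    rintro _ ⟨a, rfl, rfl⟩
    exact mem_part.2 (parity_basis a)

/-- The brackets of basis vectors. -/
def bracketBasis : FVIndex → FVIndex → FermionVirasoro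
  | .L m, .L n => ((m : ℂ) - n) • basis (.L (m + n)) +
      (if m + n = 0 then ((m : ℂ) ^ 3 - m) / 12 else 0) • basis .c
  | .L m, .ψ n => (-(n : ℂ) - m / 2) • basis (.ψ (m + n))
  | .ψ n, .L m => ((n : ℂ) + m / 2) • basis (.ψ (m + n))
  | .ψ m, .ψ n => (if m + n = 0 then 1 else 0 : ℂ) • basis .z
  | _, _ => 0

/-- The bilinear extension of the brackets of basis vectors. -/
def bracket : FermionVirasoro →ₗ[ℂ] FermionVirasoro →ₗ[ℂ] FermionVirasoro :=
  basis.constr ℂ fun a => basis.constr ℂ fun b => bracketBasis a b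

theorem bracket_basis (a b : FVIndex) : bracket (basis a) (basis b) = bracketBasis a b := by
  simp [bracket]

theorem bracketBasis_mem (a b : FVIndex) :
    bracketBasis a b ∈ part FermionVirasoro (indexParity a + indexParity b) := by
  have h : ∀ d, basis d ∈ part FermionVirasoro (indexParity d) :=
    fun d => mem_part.2 (parity_basis d)
  rcases a with m | m | _ | _ <;> rcases b with n | n | _ | _ <;>
    simp only [bracketBasis, indexParity, Submodule.zero_mem]
  · exact add_mem (Submodule.smul_mem _ _ (h (.L (m + n)))) (Submodule.smul_mem _ _ (h .c))
  · exact Submodule.smul_mem _ _ (h (.ψ (m + n)))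
  · exact Submodule.smul_mem _ _ (h (.ψ (n + m)))
  · exact Submodule.smul_mem _ _ (h .z)

theorem bracketBasis_skew (a b : FVIndex) : bracketBasis a b =
    -((-1 : ℂ) ^ ((indexParity a).val * (indexParity b).val) • bracketBasis b a) := by
  rcases a with m | m | _ | _ <;> rcases b with n | n | _ | _ <;>
    simp only [bracketBasis, indexParity, ZMod.val_one, ZMod.val_zero, mul_zero,
      mul_one, pow_zero, pow_one, smul_zero, neg_zero]
  · by_cases h : m + n = 0
    · obtain rfl : n = -m := by omega
      simp only [neg_add_cancel, add_neg_cancel, if_true]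
      push_cast
      module
    · have h' : n + m ≠ 0 := by omega
      rw [if_neg h, if_neg h', add_comm n m]
      module
  · module
  · module
  · rw [add_comm n m]
    module

theorem jacobi_basis (a b d : FVIndex) :
    bracket (basis a) (bracket (basis b) (basis d)) =
      bracket (bracket (basis a) (basis b)) (basis d) +
        (-1 : ℂ) ^ ((indexParity a).val * (indexParity b).val) •
          bracket (basis b) (bracket (basis a) (basis d)) := by
  rcases a with m | m | _ | _ <;> rcases b with n | n | _ | _ <;>
      rcases d with k | k | _ | _ <;>
    simp only [bracket_basis, bracketBasis, map_add, map_smul, map_zero, LinearMap.zero_apply,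
      LinearMap.add_apply, LinearMap.smul_apply, smul_zero, add_zero, indexParity, ZMod.val_one,
      ZMod.val_zero, mul_zero, mul_one, pow_zero, pow_one]
  -- L L L
  · rw [show n + (m + k) = m + (n + k) by ring, show m + n + k = m + (n + k) by ring]
    by_cases h : m + (n + k) = 0
    · obtain rfl : k = -m - n := by omega
      simp only [h, if_true]
      push_cast
      module
    · simp only [h, if_false]
      push_cast
      module
  -- L L ψ
  · rw [show n + (m + k) = m + (n + k) by ring, show m + n + k = m + (n + k) by ring]
    push_cast
    module
  -- L ψ L
  · rw [show m + k + n = m + (k + n) by ring, show k + (m + n) = m + (k + n) by ring]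
    push_cast
    module
  -- L ψ ψ
  · rw [show n + (m + k) = m + n + k by ring]
    by_cases h : m + n + k = 0
    · obtain rfl : k = -m - n := by omega
      simp only [h, if_true]
      push_cast
      module
    · simp only [h, if_false]
      module
  -- ψ L L
  · rw [show n + k + m = n + (k + m) by ring, show k + (n + m) = n + (k + m) by ring]
    push_cast
    module
  -- ψ L ψ
  · rw [show m + (n + k) = n + m + k by ring]
    by_cases h : n + m + k = 0
    · obtain rfl : k = -m - n := by omega
      simp only [h, if_true]
      push_cast
      module
    · simp only [h, if_false]
      module
  -- ψ ψ L
  · rw [show m + (k + n) = m + n + k by ring, show n + (k + m) = m + n + k by ring]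
    by_cases h : m + n + k = 0
    · obtain rfl : k = -m - n := by omega
      simp only [h, if_true]
      push_cast
      module
    · simp only [h, if_false]
      module

instance : LieSuperalgebra FermionVirasoro where
  sbracket := bracket
  sbracket_mem i j x y hx hy := by
    rw [part_eq_span] at hx hy
    induction hx using Submodule.span_induction with
    | zero => simp
    | add x x' _ _ h h' => rw [map_add, LinearMap.add_apply]; exact add_mem h h'
    | smul t x _ h => rw [map_smul, LinearMap.smul_apply]; exact Submodule.smul_mem _ _ h
    | mem x hx =>
      obtain ⟨a, rfl, rfl⟩ := hx
      induction hy using Submodule.span_induction with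
      | zero => simp
      | add y y' _ _ h h' => rw [map_add]; exact add_mem h h'
      | smul t y _ h => rw [map_smul]; exact Submodule.smul_mem _ _ h
      | mem y hy =>
        obtain ⟨b, rfl, rfl⟩ := hy
        rw [bracket_basis]
        exact bracketBasis_mem a b
  sbracket_skew i j x y hx hy := by
    rw [part_eq_span] at hx hy
    induction hx using Submodule.span_induction with
    | zero => simp
    | add x x' _ _ h h' =>
      rw [map_add, LinearMap.add_apply, map_add, h, h']
      module
    | smul t x _ h =>
      rw [map_smul, LinearMap.smul_apply, map_smul, h]
      module
    | mem x hx =>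
      obtain ⟨a, rfl, rfl⟩ := hx
      induction hy using Submodule.span_induction with
      | zero => simp
      | add y y' _ _ h h' =>
        rw [map_add, map_add, LinearMap.add_apply, h, h']
        module
      | smul t y _ h =>
        rw [map_smul, map_smul, LinearMap.smul_apply, h]
        module
      | mem y hy =>
        obtain ⟨b, rfl, rfl⟩ := hy
        rw [bracket_basis, bracket_basis]
        exact bracketBasis_skew a b
  sbracket_jacobi i j x y w hx hy := by
    rw [part_eq_span] at hx hy
    induction hx using Submodule.span_induction with
    | zero => simp
    | add x x' _ _ h h' =>
      simp only [map_add, LinearMap.add_apply, h, h']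
      module
    | smul t x _ h =>
      simp only [map_smul, LinearMap.smul_apply, h]
      module
    | mem x hx =>
      obtain ⟨a, rfl, rfl⟩ := hx
      induction hy using Submodule.span_induction with
      | zero => simp
      | add y y' _ _ h h' =>
        simp only [map_add, LinearMap.add_apply, h, h']
        module
      | smul t y _ h =>
        simp only [map_smul, LinearMap.smul_apply, h]
        module
      | mem y hy =>
        obtain ⟨b, rfl, rfl⟩ := hy
        have h : bracket (basis a) ∘ₗ bracket (basis b) = bracket (bracket (basis a) (basis b)) +
            (-1 : ℂ) ^ ((indexParity a).val * (indexParity b).val) •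
              (bracket (basis b) ∘ₗ bracket (basis a)) :=
          basis.ext fun d => jacobi_basis a b d
        exact LinearMap.congr_fun h w

/-- The degree of a basis vector. -/
def degree : FVIndex → ℤ
  | .L m => m
  | .ψ n => n
  | .c => 0
  | .z => 0

/-- The homogeneous component `S_k` of degree `k`: it is spanned by `L_k` and `ψ_k`, and
for `k = 0` also by `c` and `z`. -/
def component (k : ℤ) : Submodule ℂ FermionVirasoro :=
  Submodule.span ℂ (basis '' {a | degree a = k})

/-- A module has level `ℓ` if `z` acts as the scalar `ℓ`. -/
def HasLevel {M : Type*} [AddCommGroup M] [Module ℂ M]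
    (ρ : FermionVirasoro →ₗ[ℂ] Module.End ℂ M) (ℓ : ℂ) : Prop :=
  ∀ v : M, ρ (basis .z) v = ℓ • v

/-- The map `σ_μ` with `L_k ↦ L_k`, `ψ_n ↦ μ ψ_n`, `c ↦ c`, `z ↦ μ² z`; it is an automorphism
for `μ ≠ 0`. -/
def twist (μ : ℂ) : FermionVirasoro →ₗ[ℂ] FermionVirasoro :=
  basis.constr ℂ fun
    | .L k => basis (.L k)
    | .ψ n => μ • basis (.ψ n)
    | .c => basis .c
    | .z => μ ^ 2 • basis .z

/-- The projection onto the Virasoro algebra which kills the Fermion algebra. -/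
def toVir : FermionVirasoro →ₗ[ℂ] Vir :=
  basis.constr ℂ fun
    | .L k => Vir.basis (.L k)
    | .ψ _ => 0
    | .c => Vir.basis .c
    | .z => 0

end FermionVirasoro

/-! ## The fermionic Fock module -/

/-- The exterior algebra on generators `ξ_n`, `n ≥ 0`. -/
abbrev Fock : Type := ExteriorAlgebra ℂ (ℕ →₀ ℂ)

namespace Fock

/-- The generators `ξ_n` are odd. -/
instance : SuperSpace Fock where
  parity := (CliffordAlgebra.involute : Fock →ₐ[ℂ] Fock).toLinearMap
  parity_parity v := CliffordAlgebra.involute_involute v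

/-- The generator `ξ_n`. -/
def ξ (n : ℕ) : Fock := ExteriorAlgebra.ι ℂ (Finsupp.single n 1)

/-- Left multiplication by `ξ_n`. -/
def create (n : ℕ) : Module.End ℂ Fock := LinearMap.mulLeft ℂ (ξ n)

/-- The odd derivation `∂/∂ξ_n`. -/
def annihilate (n : ℕ) : Module.End ℂ Fock :=
  CliffordAlgebra.contractLeft (Finsupp.lapply n : (ℕ →₀ ℂ) →ₗ[ℂ] ℂ)

/-- The action of `ψ_n`, `n ∈ ℤ`. -/
def ψ (n : ℤ) : Module.End ℂ Fock :=
  if 0 < n then annihilate n.natAbs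
  else if n < 0 then create n.natAbs
  else (1 / (Real.sqrt 2 : ℂ)) • (create 0 + annihilate 0)

/-- The normal ordering `:ψ_j ψ_k:`. -/
def normalOrder (j k : ℤ) : Module.End ℂ Fock :=
  if j ≤ k then ψ j * ψ k else -(ψ k * ψ j)

theorem exists_forall_ψ_eq_zero (v : Fock) : ∃ N : ℕ, ∀ n : ℤ, (N : ℤ) < n → ψ n v = 0 := by
  induction v using CliffordAlgebra.left_induction with
  | algebraMap r =>
    refine ⟨0, fun n hn => ?_⟩
    rw [ψ, if_pos (by simpa using hn)]
    exact CliffordAlgebra.contractLeft_algebraMap _ _ r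
  | add x y hx hy =>
    obtain ⟨N, hN⟩ := hx
    obtain ⟨N', hN'⟩ := hy
    refine ⟨max N N', fun n hn => ?_⟩
    rw [map_add, hN n (by omega), hN' n (by omega), add_zero]
  | ι_mul x m hx =>
    obtain ⟨N, hN⟩ := hx
    refine ⟨max N (m.support.sup id), fun n hn => ?_⟩
    have h := hN n (by omega)
    rw [ψ, if_pos (by omega)] at h ⊢
    have hm : m n.natAbs = 0 := by
      by_contra h0
      have := Finset.le_sup (f := id) (Finsupp.mem_support_iff.2 h0)
      simp only [id] at this
      omega
    rw [annihilate] at h ⊢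
    rw [CliffordAlgebra.contractLeft_ι_mul, h]
    simp [hm]

/-- Only finitely many terms of `∑_j j :ψ_{-j} ψ_{j+k}:` are nonzero on a given vector. -/
theorem finite_support (k : ℤ) (v : Fock) :
    (Function.support fun j : ℤ => (j : ℂ) • normalOrder (-j) (j + k) v).Finite := by
  obtain ⟨N, hN⟩ := exists_forall_ψ_eq_zero v
  refine (Set.finite_Icc (-(N : ℤ)) (N - k)).subset fun j hj => ?_
  by_contra hj'
  refine hj ?_
  have h : (N : ℤ) < max (-j) (j + k) := by
    rw [Set.mem_Icc] at hj'
    omega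
  simp only [normalOrder]
  split_ifs with hjk
  · rw [max_eq_right hjk] at h
    simp [hN _ h]
  · rw [max_eq_left (by omega)] at h
    simp [hN _ h]

/-- The vertex operator `L̄_k = δ_{k,0}/16 + 1/2 ∑_{j ∈ ℤ} j :ψ_{-j} ψ_{j+k}:`. -/
def Lbar (k : ℤ) : Module.End ℂ Fock where
  toFun v := (if k = 0 then 1 / 16 else 0 : ℂ) • v +
    (1 / 2 : ℂ) • ∑ᶠ j : ℤ, (j : ℂ) • normalOrder (-j) (j + k) v
  map_add' v w := by
    simp only [map_add, smul_add]
    rw [finsum_add_distrib (finite_support k v) (finite_support k w)]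
    module
  map_smul' t v := by
    simp only [map_smul, RingHom.id_apply]
    rw [smul_add, smul_comm t (1 / 2 : ℂ), smul_finsum' t (finite_support k v), smul_comm t]
    simp only [smul_comm t]

/-- The action of the Fermion-Virasoro algebra on the Fock space: `L_k ↦ L̄_k`, `c ↦ 1/2`,
`z ↦ 1`. -/
def action : FermionVirasoro →ₗ[ℂ] Module.End ℂ Fock :=
  FermionVirasoro.basis.constr ℂ fun
    | .L k => Lbar k
    | .ψ n => ψ n
    | .c => (1 / 2 : ℂ) • LinearMap.id
    | .z => LinearMap.id

/-- The action twisted by `σ_μ`. -/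
def twistedAction (μ : ℂ) : FermionVirasoro →ₗ[ℂ] Module.End ℂ Fock :=
  action ∘ₗ FermionVirasoro.twist μ

end Fock

/-! ## Virasoro modules as modules over the Fermion-Virasoro algebra -/

section Inflation

variable (V : Type*) [AddCommGroup V] [Module ℂ V] [LieRingModule Vir V] [LieModule ℂ Vir V]

/-- The action of the Virasoro algebra on one of its modules. -/
def virAction : Vir →ₗ[ℂ] Module.End ℂ V :=
  (LieModule.toEnd ℂ Vir V : Vir →ₗ[ℂ] Module.End ℂ V)

/-- The module `V^S` over the Fermion-Virasoro algebra: the Virasoro module `V`, placed in even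
parity, on which the Fermion algebra acts by zero. -/
def inflation : FermionVirasoro →ₗ[ℂ] Module.End ℂ (PureEven V) :=
  (virAction V ∘ₗ FermionVirasoro.toVir : FermionVirasoro →ₗ[ℂ] Module.End ℂ V)

theorem inflation_apply (x : FermionVirasoro) (v : V) :
    inflation V x v = (⁅FermionVirasoro.toVir x, v⁆ : V) :=
  rfl

end Inflation

end

noncomputable section

open SuperSpace LieSuperalgebra

/-! ## Smooth modules over the infinite-dimensional Clifford algebra -/

/-! Rescaled by a square root `μ` of the level, the fermions on `M` satisfy the Clifford relations,
and smoothness makes the normally ordered sums in them finite on each vector. These sums form a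
second Virasoro action on `M` (`vira`), of central charge 1/2, with the same commutators with the
fermions as the given one (`vira_vira`, `vira_Ψ`). Hence the difference of the two actions, `coset`,
commutes with all fermions, and is again a Virasoro action, with `c` shifted by 1/2
(`coset_fermion`, `coset_bracket`).

The vector space underlying `V` is the space of even vectors killed by all positive modes; the coset
action preserves it. The zero mode is odd, preserves the vacuum vectors and squares to 1/2, so it
exchanges even and odd vacuum vectors bijectively. The Fock space has a universal property, because
it is a Clifford algebra after a change of quadratic form. It yields a map from Fock ⊗ `V` to `M`,
which is onto because vacuum vectors generate (`eq_top_of_vacuum`), and injective because a nonzero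
kernel would contain a vacuum vector (`exists_vacuum`, `exists_eq_of_vacuum`). Under this map the
given Virasoro action becomes the Fock action plus the coset action (`act_creator`), that is, the
tensor product action. A coset-stable subspace `U` of `V` gives the graded submodule generated by
Fock ⊗ `U`, so simplicity of `M` forces simplicity of `V`. -/

/-- The operators `Ψ n`, `n ∈ ℤ`, satisfy `Ψ m Ψ n + Ψ n Ψ m = δ_{m,-n}`, and every vector is
killed by `Ψ n` for `n` large. -/
structure IsCliffordModule {M : Type*} [AddCommGroup M] [Module ℂ M]
    (Ψ : ℤ → Module.End ℂ M) : Prop where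
  anticomm : ∀ m n v, Ψ m (Ψ n v) = (if m + n = 0 then v else 0) - Ψ n (Ψ m v)
  eventually_zero : ∀ v, ∃ N : ℕ, ∀ n : ℤ, (N : ℤ) < n → Ψ n v = 0

namespace IsCliffordModule

variable {M : Type*} [AddCommGroup M] [Module ℂ M] {Ψ : ℤ → Module.End ℂ M}

/-- The normally ordered product of two of the operators `Ψ n`. -/
def normalOrder (Ψ : ℤ → Module.End ℂ M) (a b : ℤ) : Module.End ℂ M :=
  if a ≤ b then Ψ a * Ψ b else -(Ψ b * Ψ a)

theorem apply_self (h : IsCliffordModule Ψ) (a : ℤ) (v : M) :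
    Ψ a (Ψ a v) = (if a = 0 then 1 / 2 else 0 : ℂ) • v := by
  have h1 := h.anticomm a a v
  have h2 : (2 : ℂ) • Ψ a (Ψ a v) = if a + a = 0 then v else 0 := by
    rw [two_smul]
    nth_rewrite 1 [h1]
    simp
  have h3 : Ψ a (Ψ a v) = (1 / 2 : ℂ) • (2 : ℂ) • Ψ a (Ψ a v) := by
    rw [smul_smul]; norm_num
  rw [h3, h2]
  by_cases ha : a = 0
  · simp [ha]
  · rw [if_neg (by omega), if_neg ha]
    simp

/-- Reordering costs a scalar only for opposite modes in the wrong order. These scalars are the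
source of the central term. -/
theorem apply_apply_eq (h : IsCliffordModule Ψ) (a b : ℤ) (v : M) :
    Ψ a (Ψ b v) =
      normalOrder Ψ a b v + (if a + b = 0 then if b < a then 1 else 0 else 0 : ℂ) • v := by
  unfold normalOrder
  by_cases hab : a ≤ b
  · simp [hab, not_lt.2 hab]
  · rw [h.anticomm a b v]
    by_cases h0 : a + b = 0
    · simp [hab, not_le.1 hab, h0]
      abel
    · simp [hab, h0]

/-- Normal ordering is antisymmetric off the diagonal. For equal indices both products are the
square of one mode, which survives only for the zero mode, twice 1/2. -/
theorem normalOrder_add_swap (h : IsCliffordModule Ψ) (a b : ℤ) (v : M) :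
    normalOrder Ψ a b v + normalOrder Ψ b a v = (if a = b ∧ a = 0 then 1 else 0 : ℂ) • v := by
  unfold normalOrder
  rcases lt_trichotomy a b with hab | rfl | hab
  · simp [hab.le, not_le.2 hab, hab.ne]
  · simp only [le_refl, if_true, Module.End.mul_apply, h.apply_self]
    by_cases h0 : a = 0
    · simp only [h0, if_true, and_self]
      module
    · simp [h0]
  · simp [hab.le, not_le.2 hab, hab.ne']

/-- The mode of larger index acts first, and it kills `v` once `j` leaves a bounded interval.
Arbitrary coefficients are allowed because index shifts change them. -/
theorem finite_support (h : IsCliffordModule Ψ) (c : ℤ → ℂ) (k : ℤ) (v : M) :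
    (Function.support fun j : ℤ => c j • normalOrder Ψ (-j) (j + k) v).Finite := by
  obtain ⟨N, hN⟩ := h.eventually_zero v
  refine (Set.finite_Icc (-(N : ℤ)) (N - k)).subset fun j hj => ?_
  by_contra hj'
  refine hj ?_
  have h : (N : ℤ) < max (-j) (j + k) := by
    rw [Set.mem_Icc] at hj'
    omega
  simp only [normalOrder]
  split_ifs with hjk
  · rw [max_eq_right hjk] at h
    simp [hN _ h]
  · rw [max_eq_left (by omega)] at h
    simp [hN _ h]

/-! ### Virasoro operators built from the fermions -/

/-- The Virasoro operators on a smooth Clifford module. -/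
def vira (h : IsCliffordModule Ψ) (k : ℤ) : Module.End ℂ M where
  toFun v := (if k = 0 then 1 / 16 else 0 : ℂ) • v +
    (1 / 2 : ℂ) • ∑ᶠ j : ℤ, (j : ℂ) • normalOrder Ψ (-j) (j + k) v
  map_add' v w := by
    simp only [map_add, smul_add]
    rw [finsum_add_distrib (h.finite_support _ k v) (h.finite_support _ k w)]
    module
  map_smul' t v := by
    simp only [map_smul, RingHom.id_apply]
    rw [smul_add, smul_comm t (1 / 2 : ℂ), smul_finsum' t (h.finite_support _ k v), smul_comm t]
    simp only [smul_comm t]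

theorem vira_apply (h : IsCliffordModule Ψ) (k : ℤ) (v : M) :
    h.vira k v = (if k = 0 then 1 / 16 else 0 : ℂ) • v +
      (1 / 2 : ℂ) • ∑ᶠ j : ℤ, (j : ℂ) • normalOrder Ψ (-j) (j + k) v := rfl

/-- The operators are quadratic in the fermions, so a sign in the intertwining relation squares
away. The case `s = -1` serves parity; `s = 1` serves the coset operators and the maps out of the
Fock space. -/
theorem map_vira {N : Type*} [AddCommGroup N] [Module ℂ N] {Θ : ℤ → Module.End ℂ N}
    (h : IsCliffordModule Ψ) (h' : IsCliffordModule Θ) (f : M →ₗ[ℂ] N) (s : ℂ) (hs : s * s = 1)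
    (hf : ∀ n v, f (Ψ n v) = s • Θ n (f v)) (k : ℤ) (v : M) :
    f (h.vira k v) = h'.vira k (f v) := by
  rw [vira_apply, vira_apply, map_add, map_smul, map_smul, map_finsum f (h.finite_support _ k v)]
  congr 3
  funext j
  rw [map_smul]
  congr 1
  unfold normalOrder
  split_ifs <;> simp [hf, smul_smul, hs]

/-- Moving `Ψ n` through the quadratic terms leaves contractions at `j = -m - n` and `j = n` only.
Half of their coefficients `-m - n` and `-n` gives the coefficient in the bracket of `L_m` with
`ψ_n`. -/
theorem vira_Ψ (h : IsCliffordModule Ψ) (m n : ℤ) (v : M) :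
    h.vira m (Ψ n v) = Ψ n (h.vira m v) + (-(n : ℂ) - m / 2) • Ψ (m + n) v := by
  have key : ∀ j : ℤ, (j : ℂ) • normalOrder Ψ (-j) (j + m) (Ψ n v) =
      Ψ n ((j : ℂ) • normalOrder Ψ (-j) (j + m) v) +
        ((if j = -m - n then (j : ℂ) • Ψ (-j) v else 0) +
          if j = n then -(j : ℂ) • Ψ (j + m) v else 0) := by
    intro j
    have e1 : j + m + n = 0 ↔ j = -m - n := by omega
    have e2 : -j + n = 0 ↔ j = n := by omega
    by_cases h1 : -j ≤ j + m <;>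
      simp only [normalOrder, h1, if_true, if_false, LinearMap.neg_apply, Module.End.mul_apply,
        map_neg, map_smul, h.anticomm (j + m) n, h.anticomm (-j) n, e1, e2, map_sub] <;>
      split_ifs <;> (try simp only [map_zero]) <;> module
  rw [vira_apply, vira_apply, map_add, map_smul, map_smul,
    map_finsum (Ψ n) (h.finite_support _ m v), finsum_congr key, finsum_add_distrib,
    finsum_add_distrib,
    finsum_eq_single (fun j => if j = -m - n then (j : ℂ) • Ψ (-j) v else 0) (-m - n)
      (fun x hx => if_neg hx),
    finsum_eq_single (fun j => if j = n then -(j : ℂ) • Ψ (j + m) v else 0) n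
      (fun x hx => if_neg hx), if_pos rfl, if_pos rfl]
  · rw [show -(-m - n) = m + n by ring, add_comm n m]
    push_cast
    module
  · exact (Set.finite_singleton (-m - n)).subset fun x hx => by
      by_contra hx'
      exact hx (if_neg hx')
  · exact (Set.finite_singleton n).subset fun x hx => by
      by_contra hx'
      exact hx (if_neg hx')
  · refine (h.finite_support (fun j => (j : ℂ)) m v).subset fun x hx hx' => hx ?_
    simp only at hx' ⊢
    rw [hx', map_zero]
  · refine (Set.toFinite {-m - n, n}).subset fun x hx => ?_
    by_contra hx'
    rw [Set.mem_insert_iff, Set.mem_singleton_iff, not_or] at hx'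
    refine hx ?_
    simp only
    rw [if_neg hx'.1, if_neg hx'.2, add_zero]

/-- The reflection `j ↦ -k - j` exchanges the two factors, so twice the sum is a sum of the defects
of antisymmetry, and only `j = k = 0` has one. -/
theorem finsum_normalOrder (h : IsCliffordModule Ψ) (k : ℤ) (v : M) :
    ∑ᶠ j : ℤ, normalOrder Ψ (-j) (j + k) v = (if k = 0 then 1 / 2 else 0 : ℂ) • v := by
  have hfin : (Function.support fun j : ℤ => normalOrder Ψ (-j) (j + k) v).Finite := by
    simpa using h.finite_support (fun _ => 1) k v
  have h1 : ∑ᶠ j : ℤ, normalOrder Ψ (j + k) (-j) v = ∑ᶠ j : ℤ, normalOrder Ψ (-j) (j + k) v := by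
    rw [← finsum_comp_equiv (Equiv.subLeft (-k))]
    refine finsum_congr fun j => ?_
    simp only [Equiv.subLeft_apply]
    congr 2
    · ring
    · ring
  have hfin' : (Function.support fun j : ℤ => normalOrder Ψ (j + k) (-j) v).Finite := by
    refine (hfin.preimage (Equiv.subLeft (-k)).injective.injOn).subset fun j hj => ?_
    simp only [Set.mem_preimage, Function.mem_support, Equiv.subLeft_apply] at hj ⊢
    convert hj using 3
    · ring
    · ring
  have h2 := finsum_add_distrib hfin hfin'
  rw [h1, finsum_eq_single _ 0] at h2
  · rw [h.normalOrder_add_swap] at h2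
    have h3 : ∀ x : M, x = (1 / 2 : ℂ) • (x + x) := fun x => by module
    rw [h3 (∑ᶠ j : ℤ, _), ← h2]
    by_cases hk : k = 0
    · simp [hk]
    · rw [if_neg (by omega), if_neg hk]
      simp
  · intro x hx
    rw [h.normalOrder_add_swap, if_neg (by omega), zero_smul]

/-- The difference of indicators is the signed indicator of the interval between 0 and `m`, so one
formula covers both signs of `m`. -/
theorem finsum_telescope (f G : ℤ → ℂ) (hG : ∀ j, G (j + 1) - G j = f j) (m : ℤ) :
    (Function.support fun j : ℤ =>
      f j * ((if j < m then 1 else 0) - if j < 0 then 1 else 0)).Finite ∧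
    ∑ᶠ j : ℤ, f j * ((if j < m then 1 else 0) - if j < 0 then 1 else 0) = G m - G 0 := by
  have step : ∀ m, (fun j : ℤ => f j * ((if j < m + 1 then 1 else 0) - if j < 0 then 1 else 0)) =
      fun j => f j * ((if j < m then 1 else 0) - if j < 0 then 1 else 0) +
        if j = m then f j else 0 := by
    intro m
    funext j
    by_cases h1 : j = m
    · subst h1
      simp only [lt_add_one, lt_irrefl, if_true, if_false]
      ring
    · have : j < m + 1 ↔ j < m := by omega
      simp [h1, this]
  have hs : ∀ m, (Function.support fun j : ℤ => if j = m then f j else 0).Finite := fun m =>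
    (Set.finite_singleton m).subset fun x hx => by
      by_contra hx'
      exact hx (if_neg hx')
  have hs' : ∀ m, ∑ᶠ j : ℤ, (if j = m then f j else 0) = f m := fun m => by
    rw [finsum_eq_single _ m (fun x hx => by rw [if_neg hx]), if_pos rfl]
  induction m using Int.induction_on with
  | zero => simp
  | succ m ih =>
    rw [step]
    refine ⟨(ih.1.union (hs m)).subset (Function.support_add _ _), ?_⟩
    rw [finsum_add_distrib ih.1 (hs _), ih.2, hs', ← hG]
    ring
  | pred m ih =>
    have e := step (-(m : ℤ) - 1)
    rw [sub_add_cancel] at e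
    have e' : (fun j : ℤ => f j *
        ((if j < -(m : ℤ) - 1 then 1 else 0) - if j < 0 then 1 else 0)) =
        fun j => f j * ((if j < -(m : ℤ) then 1 else 0) - if j < 0 then 1 else 0) -
          if j = -(m : ℤ) - 1 then f j else 0 := by
      funext j
      rw [eq_sub_iff_add_eq]
      exact (congrFun e j).symm
    rw [e']
    refine ⟨(ih.1.union (hs (-(m : ℤ) - 1))).subset (Function.support_sub _ _), ?_⟩
    rw [finsum_sub_distrib ih.1 (hs _), ih.2, hs', ← hG, sub_add_cancel]
    ring

/-- The Leibniz rule with `vira_Ψ` gives products that need not be normally ordered; the scalar is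
the cost of reordering them. -/
theorem vira_normalOrder (h : IsCliffordModule Ψ) (m a b : ℤ) (v : M) :
    h.vira m (normalOrder Ψ a b v) = normalOrder Ψ a b (h.vira m v) +
      ((-(a : ℂ) - m / 2) • normalOrder Ψ (a + m) b v +
        (-(b : ℂ) - m / 2) • normalOrder Ψ a (b + m) v) +
      (if a + b + m = 0 then ((b : ℂ) - a) / 2 *
        ((if b < a + m then 1 else 0) - if b + m < a then 1 else 0) else 0 : ℂ) • v := by
  have h1 := h.apply_apply_eq (a + m) b v
  have h2 := h.apply_apply_eq a (b + m) v
  have h3 := h.anticomm b (a + m) v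
  have h4 := h.anticomm (b + m) a v
  have key : h.vira m (normalOrder Ψ a b v) = normalOrder Ψ a b (h.vira m v) +
      (-(a : ℂ) - m / 2) • Ψ (a + m) (Ψ b v) + (-(b : ℂ) - m / 2) • Ψ a (Ψ (b + m) v) := by
    by_cases hab : a ≤ b
    · simp only [normalOrder, hab, if_true, Module.End.mul_apply, h.vira_Ψ, map_add, map_smul,
        add_comm m]
      module
    · simp only [normalOrder, hab, if_false, LinearMap.neg_apply, Module.End.mul_apply, h.vira_Ψ,
        map_add, map_smul, map_neg, add_comm m, h3, h4]
      -- When `a + b + m = 0` the two coefficients are opposite, so the anticommutator scalars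
      -- cancel.
      by_cases h0 : a + b + m = 0
      · obtain rfl : m = -a - b := by omega
        simp only [show b + (a + (-a - b)) = 0 by ring, show b + (-a - b) + a = 0 by ring, if_true]
        push_cast
        module
      · rw [if_neg (by omega), if_neg (by omega)]
        module
  rw [key, h1, h2]
  by_cases h0 : a + b + m = 0
  · obtain rfl : m = -a - b := by omega
    simp only [show a + (-a - b) + b = 0 by ring, show a + (b + (-a - b)) = 0 by ring,
      show a + b + (-a - b) = 0 by ring, if_true]
    push_cast
    module
  · rw [if_neg h0, if_neg (by omega), if_neg (by omega)]
    module

/-- For `m + n = 0` the reordering scalars sum to `m(m-1)(m-2)/12`, and the shift of the summation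
index leaves another `m²/4`. Half the total is `(m³ + 2m)/24`. The constant 1/16 in the zero mode
accounts for `2m/16`, which leaves `(m³ - m)/24`, the cocycle at central charge 1/2. -/
theorem vira_vira (h : IsCliffordModule Ψ) (m n : ℤ) (v : M) :
    h.vira m (h.vira n v) = h.vira n (h.vira m v) + ((m : ℂ) - n) • h.vira (m + n) v +
      (if m + n = 0 then ((m : ℂ) ^ 3 - m) / 24 else 0) • v := by
  let s : ℤ → ℂ := fun j => if m + n = 0 then ((j : ℂ) * (2 * j - m) / 2) *
        ((if j < m then 1 else 0) - if j < 0 then 1 else 0) else 0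
  have hs : (Function.support s).Finite ∧
      ∑ᶠ j, s j = if m + n = 0 then (m : ℂ) * (m - 1) * (m - 2) / 12 else 0 := by
    by_cases h0 : m + n = 0
    · simp only [s, h0, if_true]
      have := finsum_telescope (fun j => (j : ℂ) * (2 * j - m) / 2)
        (fun j => (j : ℂ) * (j - 1) * (2 * j - 1) / 6 - m * j * (j - 1) / 4)
        (fun j => by push_cast; ring) m
      refine ⟨this.1, this.2.trans ?_⟩
      push_cast
      ring
    · simp [s, h0]
  -- The shift `j ↦ j + m` brings both families of products to the same indices.
  have hfirst : ∀ c : ℤ → ℂ,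
      (Function.support fun j : ℤ => c j • normalOrder Ψ (-j + m) (j + n) v).Finite ∧
      ∑ᶠ j : ℤ, c j • normalOrder Ψ (-j + m) (j + n) v =
        ∑ᶠ j : ℤ, c (j + m) • normalOrder Ψ (-j) (j + (m + n)) v := by
    intro c
    have e : ∀ j, c (j + m) • normalOrder Ψ (-j) (j + (m + n)) v =
        (fun j => c j • normalOrder Ψ (-j + m) (j + n) v) (Equiv.addRight m j) := by
      intro j
      simp only [Equiv.coe_addRight]
      rw [show -(j + m) + m = -j by ring, show j + m + n = j + (m + n) by ring]
    constructor
    · have := h.finite_support (fun j => c (j + m)) (m + n) v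
      rw [funext e] at this
      refine (this.image (Equiv.addRight m)).subset fun j hj =>
        ⟨(Equiv.addRight m).symm j, ?_, by simp⟩
      rw [Function.mem_support, Equiv.apply_symm_apply]
      exact hj
    · rw [finsum_congr e]
      exact (finsum_comp_equiv (Equiv.addRight m)
        (f := fun j => c j • normalOrder Ψ (-j + m) (j + n) v)).symm
  have key : ∀ j : ℤ, h.vira m ((j : ℂ) • normalOrder Ψ (-j) (j + n) v) =
      (j : ℂ) • normalOrder Ψ (-j) (j + n) (h.vira m v) +
      (((j : ℂ) * (j - m / 2)) • normalOrder Ψ (-j + m) (j + n) v +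
        ((j : ℂ) * (-j - n - m / 2)) • normalOrder Ψ (-j) (j + (m + n)) v) + s j • v := by
    intro j
    rw [map_smul, h.vira_normalOrder, show j + n + m = j + (m + n) by ring]
    have hsj : s j = (j : ℂ) * (if -j + (j + n) + m = 0 then (((j + n : ℤ) : ℂ) - (-j : ℤ)) / 2 *
        ((if j + n < -j + m then 1 else 0) - if j + (m + n) < -j then 1 else 0) else 0 : ℂ) := by
      by_cases h0 : m + n = 0
      · obtain rfl : n = -m := by omega
        have e1 : j + -m < -j + m ↔ j < m := by omega
        have e2 : j < -j ↔ j < 0 := by omega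
        simp only [s, e1, e2, add_neg_cancel, add_zero, if_true,
          show -j + (j + -m) + m = 0 by ring]
        push_cast
        ring
      · simp only [s, h0, if_false]
        rw [if_neg (by omega), mul_zero]
    rw [hsj]
    push_cast
    module
  have hf0 := h.finite_support (fun j => (j : ℂ)) n (h.vira m v)
  have hf1 := hfirst fun j => (j : ℂ) * (j - m / 2)
  have hf2 := h.finite_support (fun j : ℤ => (j : ℂ) * (-j - n - m / 2)) (m + n) v
  have hf3 : (Function.support fun j => s j • v).Finite :=
    hs.1.subset fun j hj hj' => hj (by simp [hj'])
  have hf12 := (hf1.1.union hf2).subset (Function.support_add _ _)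
  -- The terms in `j²` cancel; the linear ones give the bracket and the constant `m²/2` is a
  -- multiple of the sum in `finsum_normalOrder`.
  have hcomb : ∑ᶠ j : ℤ, (((j + m : ℤ) : ℂ) * ((j + m : ℤ) - m / 2)) •
        normalOrder Ψ (-j) (j + (m + n)) v +
      ∑ᶠ j : ℤ, ((j : ℂ) * (-j - n - m / 2)) • normalOrder Ψ (-j) (j + (m + n)) v =
      ((m : ℂ) - n) • ∑ᶠ j : ℤ, (j : ℂ) • normalOrder Ψ (-j) (j + (m + n)) v +
      ((m : ℂ) ^ 2 / 2) • ∑ᶠ j : ℤ, normalOrder Ψ (-j) (j + (m + n)) v := by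
    have hf4 := h.finite_support (fun _ => 1) (m + n) v
    simp only [one_smul] at hf4
    rw [smul_finsum' _ (h.finite_support (fun j => (j : ℂ)) (m + n) v), smul_finsum' _ hf4,
      ← finsum_add_distrib (h.finite_support _ _ v) (h.finite_support _ _ v),
      ← finsum_add_distrib _ (h.finite_support _ _ v)]
    · refine finsum_congr fun j => ?_
      push_cast
      module
    · simp only [smul_smul]
      exact h.finite_support (fun j => ((m : ℂ) - n) * j) _ v
  rw [h.vira_apply n v, h.vira_apply n (h.vira m v), map_add, map_smul, map_smul,
    map_finsum _ (h.finite_support _ n v), finsum_congr key,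
    finsum_add_distrib ((hf0.union hf12).subset (Function.support_add _ _)) hf3,
    finsum_add_distrib hf0 hf12, finsum_add_distrib hf1.1 hf2, hf1.2, hcomb,
    ← finsum_smul' hs.1, hs.2, h.finsum_normalOrder, h.vira_apply (m + n) v]
  by_cases h0 : m + n = 0
  · obtain rfl : n = -m := by omega
    simp only [add_neg_cancel, if_true]
    push_cast
    module
  · simp only [h0, if_false]
    module

end IsCliffordModule

/-! ### Vacuum vectors of smooth Clifford modules -/

namespace IsCliffordModule

variable {M : Type*} [AddCommGroup M] [Module ℂ M] {Ψ : ℤ → Module.End ℂ M}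

/-- A nonzero subspace stable under the annihilation operators contains a vacuum vector. -/
theorem exists_vacuum (h : IsCliffordModule Ψ) (K : Submodule ℂ M)
    (hK : ∀ n : ℤ, 0 < n → ∀ v ∈ K, Ψ n v ∈ K) (hne : K ≠ ⊥) :
    ∃ w ∈ K, w ≠ 0 ∧ ∀ n : ℤ, 0 < n → Ψ n w = 0 := by
  have key : ∀ (N : ℕ) (w : M), w ∈ K → w ≠ 0 → (∀ n : ℤ, (N : ℤ) < n → Ψ n w = 0) →
      ∃ w ∈ K, w ≠ 0 ∧ ∀ n : ℤ, 0 < n → Ψ n w = 0 := by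
    intro N
    induction N with
    | zero => exact fun w hw hw0 hN => ⟨w, hw, hw0, by simpa using hN⟩
    | succ N ih =>
      intro w hw hw0 hN
      by_cases h0 : Ψ (N + 1) w = 0
      · refine ih w hw hw0 fun n hn => ?_
        rcases eq_or_ne n (N + 1) with rfl | hne
        · exact h0
        · exact hN n (by push_cast; omega)
      -- Replacing `w` by its nonzero image under the top mode lowers the bound: that mode squares
      -- to zero and anticommutes with the higher ones.
      · refine ih _ (hK _ (by omega) w hw) h0 fun n hn => ?_
        rcases eq_or_ne n (N + 1) with rfl | hne
        · rw [h.apply_self, if_neg (by omega), zero_smul]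
        · rw [h.anticomm, if_neg (by omega), hN n (by push_cast; omega), map_zero, sub_zero]
  obtain ⟨w, hw, hw0⟩ := K.ne_bot_iff.1 hne
  obtain ⟨N, hN⟩ := h.eventually_zero w
  exact key N w hw hw0 hN

/-- A smooth Clifford module is generated by its vacuum vectors. -/
theorem eq_top_of_vacuum (h : IsCliffordModule Ψ) (K : Submodule ℂ M)
    (hK : ∀ (n : ℤ), ∀ v ∈ K, Ψ n v ∈ K)
    (hvac : ∀ w, (∀ n : ℤ, 0 < n → Ψ n w = 0) → w ∈ K) : K = ⊤ := by
  have key : ∀ (N : ℕ) (w : M), (∀ n : ℤ, (N : ℤ) < n → Ψ n w = 0) → w ∈ K := by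
    intro N
    induction N with
    | zero => exact fun w hN => hvac w (by simpa using hN)
    | succ N ih =>
      intro w hN
      -- The anticommutator of opposite modes is 1. Both `Ψ (N + 1) (Ψ (-(N + 1)) w)` and `Ψ (N + 1)
      -- w` are killed by all modes above `N`.
      have e : w = Ψ (N + 1) (Ψ (-(N + 1)) w) + Ψ (-(N + 1)) (Ψ (N + 1) w) := by
        rw [h.anticomm, add_neg_cancel, if_pos rfl, sub_add_cancel]
      rw [e]
      refine add_mem (ih _ fun n hn => ?_) (hK _ _ (ih _ fun n hn => ?_))
      · rcases eq_or_ne n (N + 1) with rfl | hne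
        · rw [h.apply_self, if_neg (by omega), zero_smul]
        · rw [h.anticomm, if_neg (by omega), h.anticomm n, if_neg (by omega),
            hN n (by push_cast; omega)]
          simp
      · rcases eq_or_ne n (N + 1) with rfl | hne
        · rw [h.apply_self, if_neg (by omega), zero_smul]
        · rw [h.anticomm, if_neg (by omega), hN n (by push_cast; omega), map_zero, sub_zero]
  rw [eq_top_iff]
  intro w _
  obtain ⟨N, hN⟩ := h.eventually_zero w
  exact key N w hN

/-- On a vacuum vector the positive Virasoro operators vanish. -/
theorem vira_vacuum (h : IsCliffordModule Ψ) {w : M} (hw : ∀ n : ℤ, 0 < n → Ψ n w = 0) {k : ℤ}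
    (hk : 0 < k) : h.vira k w = 0 := by
  have key : ∀ j : ℤ, (j : ℂ) • normalOrder Ψ (-j) (j + k) w = 0 := by
    intro j
    unfold normalOrder
    split_ifs with hj
    · simp [hw (j + k) (by omega)]
    · simp [hw (-j) (by omega)]
  rw [h.vira_apply, finsum_congr key, if_neg hk.ne']
  simp

/-- This allows `exists_vacuum` to be applied to the kernel of the map from Fock ⊗ `V`. -/
theorem rTensor (h : IsCliffordModule Ψ) (V : Type*) [AddCommGroup V] [Module ℂ V] :
    IsCliffordModule fun n => (Ψ n).rTensor V where
  anticomm m n t := by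
    induction t with
    | zero => simp
    | tmul v w =>
      simp only [LinearMap.rTensor_tmul, h.anticomm m n v, TensorProduct.sub_tmul]
      split_ifs <;> simp
    | add s t hs ht =>
      simp only [map_add, hs, ht]
      split_ifs <;> abel
  eventually_zero t := by
    induction t with
    | zero => exact ⟨0, fun n _ => map_zero _⟩
    | tmul v w =>
      obtain ⟨N, hN⟩ := h.eventually_zero v
      exact ⟨N, fun n hn => by simp [hN n hn]⟩
    | add s t hs ht =>
      obtain ⟨N, hN⟩ := hs
      obtain ⟨N', hN'⟩ := ht
      refine ⟨max N N', fun n hn => ?_⟩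
      rw [map_add, hN n (by omega), hN' n (by omega), add_zero]

end IsCliffordModule

/-! ## The Fock space as a Clifford module -/

namespace Fock

theorem annihilate_annihilate (m n : ℕ) (v : Fock) :
    annihilate m (annihilate n v) = -annihilate n (annihilate m v) :=
  CliffordAlgebra.contractLeft_comm _ _ v

theorem create_create (m n : ℕ) (v : Fock) :
    create m (create n v) = -create n (create m v) := by
  simp only [create, LinearMap.mulLeft_apply, ξ, ← mul_assoc]
  rw [eq_neg_iff_add_eq_zero, ← add_mul, ExteriorAlgebra.ι_add_mul_swap, zero_mul]

theorem annihilate_create (m n : ℕ) (v : Fock) :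
    annihilate m (create n v) = (if m = n then v else 0) - create n (annihilate m v) := by
  simp only [create, LinearMap.mulLeft_apply, ξ, annihilate]
  refine (CliffordAlgebra.contractLeft_ι_mul _ _ v).trans ?_
  congr 1
  by_cases hmn : m = n
  · simp [hmn]
  · simp [hmn]

theorem create_self (n : ℕ) (v : Fock) : create n (create n v) = 0 := by
  simp [create, ξ, ← mul_assoc]

theorem annihilate_self (n : ℕ) (v : Fock) : annihilate n (annihilate n v) = 0 :=
  CliffordAlgebra.contractLeft_contractLeft _ v

theorem ψ_of_pos {n : ℤ} (hn : 0 < n) : ψ n = annihilate n.natAbs := if_pos hn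

theorem ψ_of_neg {n : ℤ} (hn : n < 0) : ψ n = create n.natAbs := by
  rw [ψ, if_neg hn.not_gt, if_pos hn]

theorem ψ_zero : ψ 0 = (1 / (Real.sqrt 2 : ℂ)) • (create 0 + annihilate 0) := by simp [ψ]

theorem sqrt_two_mul_self : (Real.sqrt 2 : ℂ) * Real.sqrt 2 = 2 := by
  rw [← Complex.ofReal_mul, Real.mul_self_sqrt zero_le_two, Complex.ofReal_ofNat]

theorem sqrt_two_ne_zero : (Real.sqrt 2 : ℂ) ≠ 0 := by simp

theorem ψ_zero_ψ_zero (v : Fock) : ψ 0 (ψ 0 v) = (1 / 2 : ℂ) • v := by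
  have hc : 1 / (Real.sqrt 2 : ℂ) * (1 / Real.sqrt 2) = 1 / 2 := by
    rw [div_mul_div_comm, sqrt_two_mul_self, one_mul]
  rw [← hc, ψ_zero]
  simp only [LinearMap.smul_apply, LinearMap.add_apply, map_smul, map_add, create_self,
    annihilate_self, annihilate_create, if_true]
  module

theorem isCliffordModule : IsCliffordModule ψ where
  anticomm m n v := by
    rcases lt_trichotomy m 0 with hm | rfl | hm <;> rcases lt_trichotomy n 0 with hn | rfl | hn
    · rw [ψ_of_neg hm, ψ_of_neg hn, if_neg (by omega), zero_sub, create_create]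
    · rw [ψ_of_neg hm, if_neg (by omega), ψ_zero]
      simp only [LinearMap.smul_apply, LinearMap.add_apply, map_smul, map_add,
        create_create m.natAbs 0, annihilate_create]
      rw [if_neg (by omega)]
      module
    · have e : m + n = 0 ↔ n.natAbs = m.natAbs := by omega
      rw [ψ_of_neg hm, ψ_of_pos hn, annihilate_create]
      simp only [e]
      abel
    · rw [ψ_of_neg hn, if_neg (by omega), ψ_zero]
      simp only [LinearMap.smul_apply, LinearMap.add_apply, map_smul, map_add,
        create_create 0 n.natAbs, annihilate_create]
      rw [if_neg (by omega)]
      module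
    · simp only [ψ_zero_ψ_zero, add_zero, if_true]
      module
    · rw [ψ_of_pos hn, if_neg (by omega), ψ_zero]
      simp only [LinearMap.smul_apply, LinearMap.add_apply, map_smul, map_add,
        annihilate_annihilate 0 n.natAbs, annihilate_create]
      rw [if_neg (by omega)]
      module
    · have e : m + n = 0 ↔ m.natAbs = n.natAbs := by omega
      rw [ψ_of_pos hm, ψ_of_neg hn, annihilate_create]
      simp only [e]
    · rw [ψ_of_pos hm, if_neg (by omega), ψ_zero]
      simp only [LinearMap.smul_apply, LinearMap.add_apply, map_smul, map_add,
        annihilate_annihilate m.natAbs 0, annihilate_create]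
      rw [if_neg (by omega)]
      module
    · rw [ψ_of_pos hm, ψ_of_pos hn, if_neg (by omega), zero_sub, annihilate_annihilate]
  eventually_zero := exists_forall_ψ_eq_zero

/-- All results on `vira` thereby apply to the Fock space. -/
theorem Lbar_eq_vira (k : ℤ) : Lbar k = isCliffordModule.vira k := rfl

theorem parity_apply (v : Fock) : parity v = CliffordAlgebra.involute v := rfl

theorem parity_create (n : ℕ) (v : Fock) : parity (create n v) = -create n (parity v) := by
  simp only [parity_apply, create, LinearMap.mulLeft_apply, ξ, map_mul]
  rw [show CliffordAlgebra.involute (ExteriorAlgebra.ι ℂ (Finsupp.single n (1 : ℂ))) =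
    -ExteriorAlgebra.ι ℂ (Finsupp.single n (1 : ℂ)) from CliffordAlgebra.involute_ι _, neg_mul]

theorem parity_annihilate (n : ℕ) (v : Fock) :
    parity (annihilate n v) = -annihilate n (parity v) := by
  simp only [parity_apply, annihilate]
  induction v using CliffordAlgebra.left_induction with
  | algebraMap r => simp
  | add x y hx hy => simp only [map_add, hx, hy, neg_add]
  | ι_mul x m hx =>
    rw [CliffordAlgebra.contractLeft_ι_mul, map_sub, map_smul, map_mul, map_mul, hx,
      CliffordAlgebra.involute_ι, neg_mul, neg_mul]
    refine Eq.trans ?_ (congrArg Neg.neg (map_neg _ _).symm)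
    rw [CliffordAlgebra.contractLeft_ι_mul]
    simp only [mul_neg]
    abel

theorem parity_ψ (n : ℤ) (v : Fock) : parity (ψ n v) = (-1 : ℂ) • ψ n (parity v) := by
  rw [neg_one_smul]
  rcases lt_trichotomy n 0 with hn | rfl | hn
  · rw [ψ_of_neg hn, parity_create]
  · rw [ψ_zero]
    simp only [LinearMap.smul_apply, LinearMap.add_apply, map_smul, map_add, parity_create,
      parity_annihilate]
    module
  · rw [ψ_of_pos hn, parity_annihilate]

theorem parity_Lbar (k : ℤ) (v : Fock) : parity (Lbar k v) = Lbar k (parity v) :=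
  isCliffordModule.map_vira isCliffordModule parity (-1) (by norm_num) parity_ψ k v

end Fock

/-! ## Supermodules given on the basis -/

namespace FermionVirasoro

theorem basis_mem (a : FVIndex) : basis a ∈ part FermionVirasoro (indexParity a) :=
  mem_part.2 (parity_basis a)

theorem isSuperModule_of_basis {M : Type*} [AddCommGroup M] [Module ℂ M] [SuperSpace M]
    {ρ : FermionVirasoro →ₗ[ℂ] Module.End ℂ M}
    (hpar : ∀ a v, parity (ρ (basis a) v) =
      (-1 : ℂ) ^ (indexParity a).val • ρ (basis a) (parity v))
    (hbr : ∀ a b v, ρ (bracketBasis a b) v = ρ (basis a) (ρ (basis b) v) -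
      (-1 : ℂ) ^ ((indexParity a).val * (indexParity b).val) • ρ (basis b) (ρ (basis a) v)) :
    IsSuperModule ρ where
  act_mem i j x v hx hv := by
    rw [part_eq_span] at hx
    induction hx using Submodule.span_induction with
    | zero => simp
    | add x x' _ _ h h' => rw [map_add, LinearMap.add_apply]; exact add_mem h h'
    | smul t x _ h => rw [map_smul, LinearMap.smul_apply]; exact Submodule.smul_mem _ _ h
    | mem x hx =>
      obtain ⟨a, rfl, rfl⟩ := hx
      rw [mem_part] at hv ⊢
      rw [hpar, hv, map_smul, smul_smul]
      congr 1
      generalize indexParity a = i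
      rcases parity_cases i with rfl | rfl <;> rcases parity_cases j with rfl | rfl <;>
        simp [ZMod.val_one, show (1 + 1 : ZMod 2) = 0 from rfl]
  act_sbracket i j x y hx hy v := by
    rw [part_eq_span] at hx hy
    induction hx using Submodule.span_induction with
    | zero => simp
    | add x x' _ _ h h' =>
      simp only [map_add, LinearMap.add_apply, h, h']
      module
    | smul t x _ h =>
      simp only [map_smul, LinearMap.smul_apply, h]
      module
    | mem x hx =>
      obtain ⟨a, rfl, rfl⟩ := hx
      induction hy using Submodule.span_induction with
      | zero => simp
      | add y y' _ _ h h' =>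
        simp only [map_add, LinearMap.add_apply, h, h']
        module
      | smul t y _ h =>
        simp only [map_smul, LinearMap.smul_apply, h]
        module
      | mem y hy =>
        obtain ⟨b, rfl, rfl⟩ := hy
        rw [← hbr, ← bracket_basis]
        rfl

end FermionVirasoro

/-! ### The Fock space as a Fermion-Virasoro module -/

namespace Fock

open FermionVirasoro

theorem twistedAction_L (μ : ℂ) (k : ℤ) : twistedAction μ (basis (.L k)) = Lbar k := by
  simp [twistedAction, twist, action]

theorem twistedAction_ψ (μ : ℂ) (n : ℤ) : twistedAction μ (basis (.ψ n)) = μ • ψ n := by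
  simp [twistedAction, twist, action]

theorem twistedAction_c (μ : ℂ) :
    twistedAction μ (basis .c) = (1 / 2 : ℂ) • LinearMap.id := by
  simp [twistedAction, twist, action]

theorem twistedAction_z (μ : ℂ) : twistedAction μ (basis .z) = μ ^ 2 • LinearMap.id := by
  simp [twistedAction, twist, action]

theorem isSuperModule_twistedAction (μ : ℂ) : IsSuperModule (twistedAction μ) := by
  refine isSuperModule_of_basis (fun a v => ?_) fun a b v => ?_
  · rcases a with m | m | _ | _ <;>
      simp [twistedAction_L, twistedAction_ψ, twistedAction_c, twistedAction_z, indexParity,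
        parity_ψ, parity_Lbar, ZMod.val_one]
  · rcases a with m | m | _ | _ <;> rcases b with n | n | _ | _ <;>
      simp only [bracketBasis, indexParity, ZMod.val_one, ZMod.val_zero, mul_zero, mul_one,
        pow_zero, pow_one, map_zero, map_add, map_smul, LinearMap.add_apply, LinearMap.smul_apply,
        LinearMap.zero_apply, LinearMap.id_apply, twistedAction_L, twistedAction_ψ,
        twistedAction_c, twistedAction_z, Lbar_eq_vira, isCliffordModule.vira_Ψ]
    · rw [isCliffordModule.vira_vira m n]
      split_ifs <;> module
    · module
    · module
    · module
    · module
    · rw [isCliffordModule.anticomm m n]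
      split_ifs <;> module
    all_goals module

theorem annihilate_one (n : ℕ) : annihilate n 1 = 0 := CliffordAlgebra.contractLeft_one _ _

/-! ## The universal property of the Fock space -/

/-- The square of the coefficient of `ξ_0`. -/
def sqForm : LinearMap.BilinForm ℂ (ℕ →₀ ℂ) :=
  LinearMap.BilinForm.linMulLin (Finsupp.lapply 0) (Finsupp.lapply 0)

theorem neg_sqForm : (-sqForm).toQuadraticMap =
    (0 : QuadraticForm ℂ (ℕ →₀ ℂ)) - sqForm.toQuadraticMap := by
  ext v
  simp

/-- The Clifford algebra with `ξ_0 ^ 2 = 1`, `ξ_n ^ 2 = 0` for `n ≥ 1` is linearly isomorphic to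
the Fock space. -/
def cliffordEquiv : CliffordAlgebra sqForm.toQuadraticMap ≃ₗ[ℂ] Fock :=
  CliffordAlgebra.changeFormEquiv neg_sqForm

theorem cliffordEquiv_one : cliffordEquiv 1 = 1 :=
  CliffordAlgebra.changeForm_one neg_sqForm

/-- Changing the form adds a contraction to left multiplication. For `ξ_0` it is `∂/∂ξ_0`, and the
sum is `√2 ψ_0`; for `n ≥ 1` it vanishes. -/
theorem cliffordEquiv_ι_mul (n : ℕ) (x : CliffordAlgebra sqForm.toQuadraticMap) :
    cliffordEquiv (CliffordAlgebra.ι _ (Finsupp.single n 1) * x) =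
      (if n = 0 then (Real.sqrt 2 : ℂ) else 1) • ψ (-n) (cliffordEquiv x) := by
  refine (CliffordAlgebra.changeForm_ι_mul neg_sqForm _ x).trans ?_
  have hB : ∀ n : ℕ, (-sqForm) (Finsupp.single n 1) =
      (if n = 0 then -1 else 0 : ℂ) • (Finsupp.lapply 0 : (ℕ →₀ ℂ) →ₗ[ℂ] ℂ) := by
    intro n
    ext m
    by_cases h : n = 0
    · simp [sqForm, h]
    · simp [sqForm, h]
  rw [hB]
  by_cases h : n = 0
  · subst h
    simp only [if_true, Nat.cast_zero, neg_zero, ψ_zero]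
    rw [LinearMap.smul_apply, smul_smul, mul_one_div_cancel sqrt_two_ne_zero, one_smul, map_smul,
      LinearMap.smul_apply, neg_one_smul, sub_neg_eq_add]
    rfl
  · rw [if_neg h, if_neg h, zero_smul, map_zero, LinearMap.zero_apply, sub_zero, one_smul,
      ψ_of_neg (by omega), Int.natAbs_neg, Int.natAbs_natCast]
    rfl

theorem ι_eq_sum {Q : QuadraticForm ℂ (ℕ →₀ ℂ)} (m : ℕ →₀ ℂ) (x : CliffordAlgebra Q) :
    CliffordAlgebra.ι Q m * x =
      m.sum fun n t => t • (CliffordAlgebra.ι Q (Finsupp.single n 1) * x) := by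
  conv_lhs => rw [← m.sum_single]
  rw [Finsupp.sum, map_sum, Finset.sum_mul]
  refine Finset.sum_congr rfl fun n _ => ?_
  rw [← Finsupp.smul_single_one, map_smul, smul_mul_assoc]

/-- The Fock space is spanned by what the `ψ_{-n}`, `n ≥ 0`, create from the vacuum. -/
theorem eq_top_of_one_mem (K : Submodule ℂ Fock) (h1 : (1 : Fock) ∈ K)
    (hψ : ∀ n : ℕ, ∀ v ∈ K, ψ (-n) v ∈ K) : K = ⊤ := by
  have key : ∀ x, cliffordEquiv x ∈ K := by
    intro x
    induction x using CliffordAlgebra.left_induction with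
    | algebraMap r =>
      rw [Algebra.algebraMap_eq_smul_one, map_smul, cliffordEquiv_one]
      exact K.smul_mem _ h1
    | add x y hx hy => rw [map_add]; exact add_mem hx hy
    | ι_mul x m hx =>
      rw [ι_eq_sum, Finsupp.sum, map_sum]
      refine sum_mem fun n _ => ?_
      rw [map_smul, cliffordEquiv_ι_mul]
      exact K.smul_mem _ (K.smul_mem _ (hψ n _ hx))
  exact eq_top_iff.2 fun v _ => by simpa using key (cliffordEquiv.symm v)

section Universal

variable {M : Type*} [AddCommGroup M] [Module ℂ M] {Ψ : ℤ → Module.End ℂ M}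

/-- The images of the `ξ_n` in a Clifford module. -/
def generator (Ψ : ℤ → Module.End ℂ M) : (ℕ →₀ ℂ) →ₗ[ℂ] Module.End ℂ M :=
  Finsupp.linearCombination ℂ fun n : ℕ =>
    (if n = 0 then (Real.sqrt 2 : ℂ) else 1) • Ψ (-n)

theorem generator_single (n : ℕ) : generator Ψ (Finsupp.single n 1) =
    (if n = 0 then (Real.sqrt 2 : ℂ) else 1) • Ψ (-n) := by
  simp [generator]

/-- By polarization it suffices to compute anticommutators on the basis. Modes of index at most zero
contract only at zero, where the factor `√2` normalizes the square to 1. -/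
theorem generator_sq (h : IsCliffordModule Ψ) (m : ℕ →₀ ℂ) :
    generator Ψ m * generator Ψ m = algebraMap ℂ _ (sqForm.toQuadraticMap m) := by
  have key : (LinearMap.mul ℂ (Module.End ℂ M)).compl₁₂ (generator Ψ) (generator Ψ) +
      ((LinearMap.mul ℂ (Module.End ℂ M)).compl₁₂ (generator Ψ) (generator Ψ)).flip =
      (2 : ℂ) • sqForm.compr₂ (Algebra.linearMap ℂ (Module.End ℂ M)) := by
    ext a b v
    simp only [LinearMap.coe_comp, Function.comp_apply, Finsupp.lsingle_apply,
      LinearMap.add_apply, LinearMap.compl₁₂_apply, LinearMap.flip_apply, LinearMap.mul_apply',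
      generator_single, LinearMap.smul_apply, LinearMap.compr₂_apply, Module.End.mul_apply,
      map_smul, Algebra.linearMap_apply, Module.algebraMap_end_apply, h.anticomm (-a) (-b)]
    by_cases hab : a = 0 ∧ b = 0
    · obtain ⟨rfl, rfl⟩ := hab
      simp only [sqForm, LinearMap.BilinForm.linMulLin_apply, Finsupp.lapply_apply,
        Finsupp.single_eq_same, if_true, Nat.cast_zero, neg_zero, add_zero, smul_sub, smul_smul,
        sqrt_two_mul_self]
      module
    · have hab' : ¬ (-(a : ℤ) + -(b : ℤ) = 0) := by omega
      have h0 : sqForm (Finsupp.single a 1) (Finsupp.single b 1) = 0 := by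
        simp only [sqForm, LinearMap.BilinForm.linMulLin_apply, Finsupp.lapply_apply,
          Finsupp.single_apply]
        rcases not_and_or.1 hab with ha | hb
        · rw [if_neg ha, zero_mul]
        · rw [if_neg hb, mul_zero]
      rw [if_neg hab', h0]
      module
  have h2 := LinearMap.congr_fun₂ key m m
  simp only [LinearMap.add_apply, LinearMap.compl₁₂_apply, LinearMap.flip_apply,
    LinearMap.mul_apply', LinearMap.smul_apply, LinearMap.compr₂_apply,
    Algebra.linearMap_apply, ← two_smul ℂ] at h2
  exact smul_right_injective _ two_ne_zero h2

/-- The operator on a Clifford module which creates the given element of the Fock space. -/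
def creator (h : IsCliffordModule Ψ) : Fock →ₗ[ℂ] Module.End ℂ M :=
  (CliffordAlgebra.lift sqForm.toQuadraticMap ⟨generator Ψ, generator_sq h⟩).toLinearMap ∘ₗ
    cliffordEquiv.symm.toLinearMap

theorem creator_one (h : IsCliffordModule Ψ) : creator h 1 = 1 := by
  have : cliffordEquiv.symm 1 = 1 := by rw [LinearEquiv.symm_apply_eq, cliffordEquiv_one]
  simp [creator, this]

/-- After clearing the normalization this is multiplicativity of the lift to the Clifford algebra;
no vacuum condition is needed. -/
theorem creator_ψ_neg (h : IsCliffordModule Ψ) (n : ℕ) (x : Fock) :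
    creator h (ψ (-n) x) = Ψ (-n) * creator h x := by
  obtain ⟨y, rfl⟩ := cliffordEquiv.surjective x
  have hs : (if n = 0 then (Real.sqrt 2 : ℂ) else 1) ≠ 0 := by
    split_ifs
    · exact sqrt_two_ne_zero
    · exact one_ne_zero
  refine smul_right_injective _ hs ?_
  simp only
  rw [← map_smul, ← cliffordEquiv_ι_mul, ← smul_mul_assoc, ← generator_single]
  simp only [creator, LinearMap.comp_apply, LinearEquiv.coe_coe, LinearEquiv.symm_apply_apply,
    AlgHom.toLinearMap_apply, map_mul]
  rw [CliffordAlgebra.lift_ι_apply]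

theorem induction_on {p : Fock → Prop} (x : Fock) (h1 : p 1)
    (hadd : ∀ x y, p x → p y → p (x + y)) (hsmul : ∀ (t : ℂ) x, p x → p (t • x))
    (hψ : ∀ (n : ℕ) x, p x → p (ψ (-n) x)) : p x := by
  have := eq_top_of_one_mem
    { carrier := {x | p x}
      add_mem' := fun {x y} hx hy => hadd x y hx hy
      zero_mem' := by simpa using hsmul 0 1 h1
      smul_mem' := fun t x hx => hsmul t x hx } h1 hψ
  exact (this ▸ Submodule.mem_top : x ∈ _)

/-- An operator which commutes with the Clifford action commutes with the creators. -/
theorem map_creator (h : IsCliffordModule Ψ) (T : Module.End ℂ M)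
    (hT : ∀ n v, T (Ψ n v) = Ψ n (T v)) (x : Fock) (v : M) :
    T (creator h x v) = creator h x (T v) := by
  induction x using induction_on with
  | h1 => simp [creator_one]
  | hadd x y hx hy => simp only [map_add, LinearMap.add_apply, hx, hy]
  | hsmul t x hx => simp only [map_smul, LinearMap.smul_apply, hx]
  | hψ n x hx => simp only [creator_ψ_neg, Module.End.mul_apply, hT, hx]

/-- A positive mode anticommutes past the creation modes in the same way on both sides until it
meets `1`, respectively `v`, and both are killed. -/
theorem creator_ψ (h : IsCliffordModule Ψ) {v : M} (hv : ∀ n : ℤ, 0 < n → Ψ n v = 0) (n : ℤ)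
    (x : Fock) : creator h (ψ n x) v = Ψ n (creator h x v) := by
  rcases le_or_gt n 0 with hn | hn
  · obtain ⟨k, rfl⟩ : ∃ k : ℕ, n = -k := ⟨n.natAbs, by omega⟩
    rw [creator_ψ_neg, Module.End.mul_apply]
  · induction x using induction_on with
    | h1 =>
      rw [creator_one, Module.End.one_apply, hv n hn, ψ_of_pos hn, annihilate_one, map_zero,
        LinearMap.zero_apply]
    | hadd x y hx hy => simp only [map_add, LinearMap.add_apply, hx, hy]
    | hsmul t x hx => simp only [map_smul, LinearMap.smul_apply, hx]
    | hψ k x hx =>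
      rw [isCliffordModule.anticomm, creator_ψ_neg, Module.End.mul_apply, h.anticomm n, map_sub,
        LinearMap.sub_apply, creator_ψ_neg, Module.End.mul_apply, hx]
      split_ifs <;> simp

theorem creator_parity [SuperSpace M] (h : IsCliffordModule Ψ)
    (hpar : ∀ n v, parity (Ψ n v) = -Ψ n (parity v)) (x : Fock) (v : M) :
    creator h (parity x) (parity v) = parity (creator h x v) := by
  induction x using induction_on with
  | h1 =>
    rw [creator_one, parity_apply, map_one, creator_one]
    rfl
  | hadd x y hx hy => simp only [map_add, LinearMap.add_apply, hx, hy]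
  | hsmul t x hx => simp only [map_smul, LinearMap.smul_apply, hx]
  | hψ n x hx =>
    rw [parity_ψ, neg_one_smul, map_neg, creator_ψ_neg, creator_ψ_neg, LinearMap.neg_apply,
      Module.End.mul_apply, Module.End.mul_apply, hx, hpar]

end Universal

/-! ## The vacuum vectors of the Fock space -/

/-- The projection onto the part of the Fock space which is free of `ξ_0, …, ξ_{N-1}`. -/
def killBelow : ℕ → Module.End ℂ Fock
  | 0 => LinearMap.id
  | N + 1 => killBelow N * (annihilate N * create N)

theorem killBelow_create {N n : ℕ} (hn : n < N) (x : Fock) : killBelow N (create n x) = 0 := by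
  induction N generalizing x with
  | zero => omega
  | succ N ih =>
    simp only [killBelow, Module.End.mul_apply]
    rcases eq_or_ne n N with rfl | hne
    · rw [create_self, map_zero, map_zero]
    · rw [create_create, map_neg, annihilate_create, if_neg hne.symm, zero_sub, neg_neg,
        ih (by omega)]

theorem killBelow_one (N : ℕ) : killBelow N 1 = 1 := by
  induction N with
  | zero => rfl
  | succ N ih =>
    rw [killBelow, Module.End.mul_apply, Module.End.mul_apply, annihilate_create, if_pos rfl,
      annihilate_one, map_zero, sub_zero, ih]

/-- The coefficient of the vacuum `1`. -/
def vacuumCoeff : Fock →ₗ[ℂ] ℂ := (ExteriorAlgebra.algebraMapInv (M := ℕ →₀ ℂ)).toLinearMap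

theorem vacuumCoeff_one : vacuumCoeff 1 = 1 := map_one ExteriorAlgebra.algebraMapInv

/-- Only finitely many generators occur in `x`, so for large `N` every nonconstant term is killed.
-/
theorem exists_killBelow_eq (x : Fock) :
    ∃ N₀ : ℕ, ∀ N, N₀ ≤ N → killBelow N x = vacuumCoeff x • (1 : Fock) := by
  induction x using CliffordAlgebra.left_induction with
  | algebraMap r =>
    refine ⟨0, fun N _ => ?_⟩
    rw [Algebra.algebraMap_eq_smul_one, map_smul, map_smul]
    erw [killBelow_one, vacuumCoeff_one]
    simp
  | add x y hx hy =>
    obtain ⟨N₁, h₁⟩ := hx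
    obtain ⟨N₂, h₂⟩ := hy
    refine ⟨max N₁ N₂, fun N hN => ?_⟩
    rw [map_add, map_add, h₁ N (by omega), h₂ N (by omega), add_smul]
  | ι_mul x m _ =>
    refine ⟨m.support.sup id + 1, fun N hN => ?_⟩
    have h0 : vacuumCoeff (CliffordAlgebra.ι 0 m * x) = 0 := by
      refine (map_mul ExteriorAlgebra.algebraMapInv _ _).trans ?_
      erw [ExteriorAlgebra.algebraMapInv, ExteriorAlgebra.lift_ι_apply]
      simp
    rw [h0, zero_smul, ι_eq_sum, Finsupp.sum, map_sum]
    refine Finset.sum_eq_zero fun n hn => ?_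
    rw [map_smul]
    have hle := Finset.le_sup (f := id) hn
    rw [id] at hle
    erw [killBelow_create (show n < N by omega) x]
    exact smul_zero _

variable {V : Type*} [AddCommGroup V] [Module ℂ V]

/-- A vector of `Fock ⊗ V` which is killed by all `∂/∂ξ_n` lies in `1 ⊗ V`. -/
theorem exists_eq_one_tmul (t : Fock ⊗[ℂ] V) (ht : ∀ n, (annihilate n).rTensor V t = 0) :
    ∃ v : V, t = 1 ⊗ₜ v := by
  -- Since `∂ξ = 1 - ξ∂`, each factor of the projection fixes `t`; for large `N` the projection of
  -- `t` lies in `1 ⊗ V`.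
  have h1 : ∀ N, (killBelow N).rTensor V t = t := by
    intro N
    induction N with
    | zero => exact LinearMap.rTensor_id_apply V Fock t
    | succ N ih =>
      have e : annihilate N * create N = LinearMap.id - create N * annihilate N := by
        refine LinearMap.ext fun x => ?_
        simp [annihilate_create]
      rw [killBelow, LinearMap.rTensor_mul, Module.End.mul_apply, e, LinearMap.rTensor_sub,
        LinearMap.sub_apply, LinearMap.rTensor_id_apply, LinearMap.rTensor_mul,
        Module.End.mul_apply, ht, map_zero, sub_zero, ih]
  have h2 : ∀ t : Fock ⊗[ℂ] V, ∃ N₀ : ℕ, ∃ v : V, ∀ N, N₀ ≤ N →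
      (killBelow N).rTensor V t = 1 ⊗ₜ v := by
    intro t
    induction t with
    | zero => exact ⟨0, 0, fun N _ => by simp⟩
    | tmul x v =>
      obtain ⟨N₀, h⟩ := exists_killBelow_eq x
      exact ⟨N₀, vacuumCoeff x • v, fun N hN => by
        rw [LinearMap.rTensor_tmul, h N hN, TensorProduct.smul_tmul]⟩
    | add s t hs ht =>
      obtain ⟨N₁, v₁, h₁⟩ := hs
      obtain ⟨N₂, v₂, h₂⟩ := ht
      exact ⟨max N₁ N₂, v₁ + v₂, fun N hN => by
        rw [map_add, h₁ N (by omega), h₂ N (by omega), TensorProduct.tmul_add]⟩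
  obtain ⟨N₀, v, h⟩ := h2 t
  exact ⟨v, (h1 N₀).symm.trans (h N₀ le_rfl)⟩

/-- The vacuum vectors of `Fock ⊗ V` are the `1 ⊗ v + ξ_0 ⊗ v'`. -/
theorem exists_eq_of_vacuum (t : Fock ⊗[ℂ] V)
    (ht : ∀ n : ℤ, 0 < n → (ψ n).rTensor V t = 0) :
    ∃ v v' : V, t = 1 ⊗ₜ v + create 0 1 ⊗ₜ v' := by
  have hn : ∀ n : ℕ, n ≠ 0 → (annihilate n).rTensor V t = 0 := by
    intro n hn
    have := ht n (by omega)
    rwa [ψ_of_pos (by omega), Int.natAbs_natCast] at this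
  have comm : ∀ m n : ℕ, ∀ t : Fock ⊗[ℂ] V, (annihilate m).rTensor V ((annihilate n).rTensor V t) =
      -(annihilate n).rTensor V ((annihilate m).rTensor V t) := by
    intro m n t
    have e : annihilate m * annihilate n = -(annihilate n * annihilate m) := by
      refine LinearMap.ext fun x => ?_
      exact annihilate_annihilate m n x
    have := congrArg (fun f => LinearMap.rTensor V f t) e
    simpa [LinearMap.rTensor_mul, LinearMap.rTensor_neg] using this
  have comm' : ∀ m n : ℕ, ∀ t : Fock ⊗[ℂ] V, (annihilate m).rTensor V ((create n).rTensor V t) =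
      (if m = n then t else 0) - (create n).rTensor V ((annihilate m).rTensor V t) := by
    intro m n t
    have e : annihilate m * create n =
        (if m = n then LinearMap.id else 0) - create n * annihilate m := by
      refine LinearMap.ext fun x => ?_
      simp only [Module.End.mul_apply, annihilate_create, LinearMap.sub_apply]
      split_ifs <;> rfl
    have := congrArg (fun f => LinearMap.rTensor V f t) e
    simp only [LinearMap.rTensor_mul, LinearMap.rTensor_sub, Module.End.mul_apply,
      LinearMap.sub_apply] at this
    rw [this]
    split_ifs <;> simp
  -- Both `∂_0 t` and `t - ξ_0 ∂_0 t` are killed by every `∂_n`; they supply the coefficients of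
  -- `ξ_0` and of `1`.
  obtain ⟨v', h'⟩ := exists_eq_one_tmul ((annihilate 0).rTensor V t) fun n => by
    rw [comm]
    rcases eq_or_ne n 0 with rfl | h0
    · rw [comm]
      have e : annihilate 0 * annihilate 0 = 0 := by
        refine LinearMap.ext fun x => ?_
        exact annihilate_self 0 x
      rw [← Module.End.mul_apply, ← LinearMap.rTensor_mul, e]
      simp
    · rw [hn n h0, map_zero, neg_zero]
  obtain ⟨v, h⟩ := exists_eq_one_tmul (t - (create 0).rTensor V ((annihilate 0).rTensor V t))
    fun n => by
      rw [map_sub, comm']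
      rcases eq_or_ne n 0 with rfl | h0
      · rw [if_pos rfl]
        have e : annihilate 0 * annihilate 0 = 0 := by
          refine LinearMap.ext fun x => ?_
          exact annihilate_self 0 x
        rw [← Module.End.mul_apply (LinearMap.rTensor V (annihilate 0)), ← LinearMap.rTensor_mul, e]
        simp
      · rw [if_neg h0, comm, hn n h0]
        simp
  refine ⟨v, v', ?_⟩
  rw [← h, h', LinearMap.rTensor_tmul, sub_add_cancel]

end Fock

/-! ## Decomposition of a Clifford module into its vacuum vectors and the Fock space -/

namespace Fock

section Decomposition

variable {M : Type*} [AddCommGroup M] [Module ℂ M] {Ψ : ℤ → Module.End ℂ M}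
variable {W : Type*} [AddCommGroup W] [Module ℂ W]

/-- The map `Fock ⊗ W → M`, `x ⊗ w ↦ x (i w)`. -/
def fromFock (h : IsCliffordModule Ψ) (i : W →ₗ[ℂ] M) : Fock ⊗[ℂ] W →ₗ[ℂ] M :=
  TensorProduct.lift ((creator h).compl₂ i)

theorem fromFock_tmul (h : IsCliffordModule Ψ) (i : W →ₗ[ℂ] M) (x : Fock) (w : W) :
    fromFock h i (x ⊗ₜ w) = creator h x (i w) := by
  simp [fromFock]

theorem fromFock_ψ (h : IsCliffordModule Ψ) {i : W →ₗ[ℂ] M}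
    (hvac : ∀ w, ∀ n : ℤ, 0 < n → Ψ n (i w) = 0) (n : ℤ) (t : Fock ⊗[ℂ] W) :
    fromFock h i ((ψ n).rTensor W t) = Ψ n (fromFock h i t) := by
  induction t with
  | zero => simp
  | tmul x w => rw [LinearMap.rTensor_tmul, fromFock_tmul, fromFock_tmul, creator_ψ h (hvac w)]
  | add s t hs ht => simp only [map_add, hs, ht]

theorem create_zero_one : create 0 1 = (Real.sqrt 2 : ℂ) • ψ (-(0 : ℕ)) 1 := by
  rw [Nat.cast_zero, neg_zero, ψ_zero, LinearMap.smul_apply, smul_smul,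
    mul_one_div_cancel sqrt_two_ne_zero, one_smul, LinearMap.add_apply, annihilate_one, add_zero]

variable [SuperSpace M]

/-- A nonzero kernel contains a nonzero `1 ⊗ v + ξ_0 ⊗ v'`, with image `i v + √2 Ψ_0 (i v')`. The
first term is even and the second odd, so both vanish, and `Ψ_0` is invertible. -/
theorem fromFock_injective (h : IsCliffordModule Ψ)
    (hpar : ∀ n v, parity (Ψ n v) = -Ψ n (parity v)) {i : W →ₗ[ℂ] M}
    (hi : Function.Injective i) (hvac : ∀ w, ∀ n : ℤ, 0 < n → Ψ n (i w) = 0)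
    (heven : ∀ w, parity (i w) = i w) : Function.Injective (fromFock h i) := by
  rw [← LinearMap.ker_eq_bot]
  by_contra hne
  obtain ⟨t, ht, ht0, htv⟩ := (isCliffordModule.rTensor W).exists_vacuum
    (LinearMap.ker (fromFock h i)) (fun n _ t ht => by
      rw [LinearMap.mem_ker] at ht ⊢
      rw [fromFock_ψ h hvac, ht, map_zero]) hne
  obtain ⟨v, v', rfl⟩ := exists_eq_of_vacuum t htv
  rw [LinearMap.mem_ker, map_add, fromFock_tmul, fromFock_tmul, creator_one, create_zero_one,
    map_smul, creator_ψ_neg, creator_one, mul_one, Nat.cast_zero, neg_zero, Module.End.one_apply,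
    LinearMap.smul_apply] at ht
  have ht' := congrArg parity ht
  rw [map_add, map_smul, hpar, heven, heven, map_zero] at ht'
  have hv : i v = 0 := by
    have : i v = (1 / 2 : ℂ) • (i v + (Real.sqrt 2 : ℂ) • Ψ 0 (i v') +
        (i v + (Real.sqrt 2 : ℂ) • -Ψ 0 (i v'))) := by module
    rw [this, ht, ht', add_zero, smul_zero]
  rw [hv, zero_add, smul_eq_zero_iff_right sqrt_two_ne_zero] at ht
  have hv' : i v' = 0 := by
    have := h.apply_self 0 (i v')
    rw [ht, map_zero, if_pos rfl] at this
    exact (smul_eq_zero.1 this.symm).resolve_left (by norm_num)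
  rw [(map_eq_zero_iff i hi).1 hv, (map_eq_zero_iff i hi).1 hv'] at ht0
  simp at ht0

theorem fromFock_surjective (h : IsCliffordModule Ψ)
    (hpar : ∀ n v, parity (Ψ n v) = -Ψ n (parity v)) {i : W →ₗ[ℂ] M}
    (hvac : ∀ w, ∀ n : ℤ, 0 < n → Ψ n (i w) = 0)
    (hsurj : ∀ v, parity v = v → (∀ n : ℤ, 0 < n → Ψ n v = 0) → ∃ w, i w = v) :
    Function.Surjective (fromFock h i) := by
  have hstable : ∀ (n : ℤ), ∀ v ∈ LinearMap.range (fromFock h i),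
      Ψ n v ∈ LinearMap.range (fromFock h i) := by
    rintro n _ ⟨t, rfl⟩
    exact ⟨_, fromFock_ψ h hvac n t⟩
  have heven : ∀ v, parity v = v → (∀ n : ℤ, 0 < n → Ψ n v = 0) →
      v ∈ LinearMap.range (fromFock h i) := by
    intro v h0 h1
    obtain ⟨w, rfl⟩ := hsurj v h0 h1
    exact ⟨1 ⊗ₜ w, by rw [fromFock_tmul, creator_one, Module.End.one_apply]⟩
  rw [← LinearMap.range_eq_top]
  refine h.eq_top_of_vacuum _ hstable fun v hv => ?_
  have hpv : ∀ n : ℤ, 0 < n → Ψ n (parity v) = 0 := fun n hn => by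
    rw [← neg_eq_zero, ← hpar, hv n hn, map_zero]
  -- Since `Ψ_0² = 1/2`, the odd part of `v` is `Ψ_0` applied to `Ψ_0 (v - parity v)`, an even
  -- vacuum vector.
  have e : v = (1 / 2 : ℂ) • (v + parity v) + Ψ 0 (Ψ 0 (v - parity v)) := by
    rw [h.apply_self, if_pos rfl]
    module
  rw [e]
  refine add_mem (Submodule.smul_mem _ _ (heven _ ?_ fun n hn => ?_))
    (hstable _ _ (heven _ ?_ fun n hn => ?_))
  · rw [map_add, parity_parity, add_comm]
  · rw [map_add, hv n hn, hpv n hn, add_zero]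
  · rw [hpar, map_sub, parity_parity, ← map_neg, neg_sub]
  · rw [h.anticomm, if_neg (by omega), map_sub, hv n hn, hpv n hn, sub_zero, map_zero, sub_zero]

end Decomposition

end Fock

theorem Vir.induction_on {p : Vir → Prop} (x : Vir) (zero : p 0)
    (add : ∀ x y, p x → p y → p (x + y)) (smul : ∀ (t : ℂ) x, p x → p (t • x))
    (basis : ∀ a, p (Vir.basis a)) : p x := by
  have h : x ∈ Submodule.span ℂ (Set.range Vir.basis) := by
    rw [Vir.basis.span_eq]
    exact Submodule.mem_top
  induction h using Submodule.span_induction with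
  | zero => exact zero
  | add x y _ _ hx hy => exact add x y hx hy
  | smul t x _ hx => exact smul t x hx
  | mem x hx =>
    obtain ⟨a, rfl⟩ := hx
    exact basis a

/-! ## The Virasoro action on the vacuum vectors -/

namespace FermionVirasoro

section Coset

variable {M : Type*} [AddCommGroup M] [Module ℂ M]
variable {ρ : FermionVirasoro →ₗ[ℂ] Module.End ℂ M} {μ : ℂ}

/-- The normalized action of the `ψ_n` on a module of level `μ ^ 2`. -/
def fermion (ρ : FermionVirasoro →ₗ[ℂ] Module.End ℂ M) (μ : ℂ) (n : ℤ) : Module.End ℂ M :=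
  μ⁻¹ • ρ (basis (.ψ n))

/-- The coset Virasoro action: the given action minus the one built from the fermions. -/
def coset (ρ : FermionVirasoro →ₗ[ℂ] Module.End ℂ M) (h : IsCliffordModule (fermion ρ μ)) :
    Vir →ₗ[ℂ] Module.End ℂ M :=
  Vir.basis.constr ℂ fun
    | .L k => ρ (basis (.L k)) - h.vira k
    | .c => ρ (basis .c) - (1 / 2 : ℂ) • LinearMap.id

theorem coset_L (h : IsCliffordModule (fermion ρ μ)) (k : ℤ) (v : M) :
    coset ρ h (Vir.basis (.L k)) v = ρ (basis (.L k)) v - h.vira k v := by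
  simp [coset]

theorem coset_c (h : IsCliffordModule (fermion ρ μ)) (v : M) :
    coset ρ h (Vir.basis .c) v = ρ (basis .c) v - (1 / 2 : ℂ) • v := by
  simp [coset]

theorem ψ_eq_smul_fermion (hμ : μ ≠ 0) (n : ℤ) (v : M) :
    ρ (basis (.ψ n)) v = μ • fermion ρ μ n v := by
  rw [fermion, LinearMap.smul_apply, smul_inv_smul₀ hμ]

variable [SuperSpace M]

theorem act_bracketBasis (hmod : IsSuperModule ρ) (a b : FVIndex) (v : M) :
    ρ (bracketBasis a b) v = ρ (basis a) (ρ (basis b) v) -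
      (-1 : ℂ) ^ ((indexParity a).val * (indexParity b).val) • ρ (basis b) (ρ (basis a) v) := by
  rw [← bracket_basis]
  exact hmod.act_sbracket _ _ _ _ (basis_mem a) (basis_mem b) v

/-- Splitting `v` into even and odd parts turns the grading condition into a commutation rule with
the parity operator. -/
theorem parity_act (hmod : IsSuperModule ρ) (a : FVIndex) (v : M) :
    parity (ρ (basis a) v) = (-1 : ℂ) ^ (indexParity a).val • ρ (basis a) (parity v) := by
  obtain ⟨v₀, hv₀, v₁, hv₁, rfl⟩ := Submodule.mem_sup.1
    ((isCompl_part (V := M)).sup_eq_top ▸ Submodule.mem_top : v ∈ part M 0 ⊔ part M 1)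
  have h₀ := mem_part.1 (hmod.act_mem _ _ _ _ (basis_mem a) hv₀)
  have h₁ := mem_part.1 (hmod.act_mem _ _ _ _ (basis_mem a) hv₁)
  rw [mem_part] at hv₀ hv₁
  simp only [map_add, h₀, h₁, hv₀, hv₁, map_smul, smul_add, smul_smul]
  generalize indexParity a = i
  rcases parity_cases i with rfl | rfl <;>
    simp [ZMod.val_one, show (1 + 1 : ZMod 2) = 0 from rfl]

theorem parity_fermion (hmod : IsSuperModule ρ) (n : ℤ) (v : M) :
    parity (fermion ρ μ n v) = -fermion ρ μ n (parity v) := by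
  simp [fermion, parity_act hmod, indexParity, ZMod.val_one]

theorem isCliffordModule_fermion (hmod : IsSuperModule ρ) (hsmooth : IsSmooth component ρ)
    (hμ : μ ≠ 0) (hlevel : HasLevel ρ (μ ^ 2)) : IsCliffordModule (fermion ρ μ) where
  anticomm m n v := by
    have h := act_bracketBasis hmod (.ψ m) (.ψ n) v
    simp only [bracketBasis, indexParity, ZMod.val_one, mul_one, pow_one, map_smul,
      LinearMap.smul_apply, hlevel v, neg_one_smul, sub_neg_eq_add] at h
    have h' : ρ (basis (.ψ m)) (ρ (basis (.ψ n)) v) =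
        (if m + n = 0 then 1 else 0 : ℂ) • μ ^ 2 • v - ρ (basis (.ψ n)) (ρ (basis (.ψ m)) v) := by
      rw [h, add_sub_cancel_right]
    simp only [fermion, LinearMap.smul_apply, map_smul, h', smul_sub]
    congr 1
    split_ifs
    · rw [one_smul, smul_smul, smul_smul, show μ⁻¹ * μ⁻¹ * μ ^ 2 = 1 by field_simp, one_smul]
    · simp
  eventually_zero v := by
    obtain ⟨N, hN⟩ := hsmooth v
    refine ⟨N, fun n hn => ?_⟩
    rw [fermion, LinearMap.smul_apply,
      hN n hn _ (Submodule.subset_span ⟨.ψ n, rfl, rfl⟩), smul_zero]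

/-- The given `L_k` and `vira k` have the same commutator with every fermion, so their difference
has none. -/
theorem coset_fermion (hmod : IsSuperModule ρ) (hμ : μ ≠ 0)
    (h : IsCliffordModule (fermion ρ μ)) (x : Vir) (n : ℤ) (v : M) :
    coset ρ h x (fermion ρ μ n v) = fermion ρ μ n (coset ρ h x v) := by
  induction x using Vir.induction_on with
  | zero => simp
  | add x y hx hy => simp only [map_add, LinearMap.add_apply, hx, hy]
  | smul t x hx => simp only [map_smul, LinearMap.smul_apply, hx]
  | basis a =>
    rcases a with k | _
    · have hb := act_bracketBasis hmod (.L k) (.ψ n) v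
      simp only [bracketBasis, indexParity, ZMod.val_zero, zero_mul, pow_zero, one_smul, map_smul,
        LinearMap.smul_apply, ψ_eq_smul_fermion hμ] at hb
      rw [coset_L, coset_L, h.vira_Ψ, map_sub]
      have hb' : μ • ρ (basis (.L k)) (fermion ρ μ n v) =
          μ • (fermion ρ μ n (ρ (basis (.L k)) v) +
            (-(n : ℂ) - k / 2) • fermion ρ μ (k + n) v) := by
        rw [smul_add, smul_comm μ (_ - _ : ℂ), hb]
        abel
      rw [smul_right_injective M hμ hb']
      abel
    · have hb := act_bracketBasis hmod .c (.ψ n) v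
      simp only [bracketBasis, indexParity, ZMod.val_zero, zero_mul, pow_zero, one_smul, map_smul,
        map_zero, LinearMap.zero_apply, ψ_eq_smul_fermion hμ] at hb
      rw [coset_c, coset_c, map_sub, map_smul,
        smul_right_injective M hμ (sub_eq_zero.1 hb.symm)]

theorem parity_coset (hmod : IsSuperModule ρ) (h : IsCliffordModule (fermion ρ μ)) (x : Vir)
    (v : M) : parity (coset ρ h x v) = coset ρ h x (parity v) := by
  induction x using Vir.induction_on with
  | zero => simp
  | add x y hx hy => simp only [map_add, LinearMap.add_apply, hx, hy]
  | smul t x hx => simp only [map_smul, LinearMap.smul_apply, hx]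
  | basis a =>
    rcases a with k | _
    · rw [coset_L, coset_L, map_sub, parity_act hmod,
        h.map_vira h parity (-1) (by norm_num) fun n v => by rw [parity_fermion hmod, neg_one_smul]]
      simp [indexParity]
    · rw [coset_c, coset_c, map_sub, map_smul, parity_act hmod]
      simp [indexParity]

/-- Commuting with the fermions, the coset operators commute with `vira` as well. The bracket of two
given operators is therefore the sum of the coset and the fermionic brackets, and subtracting the
latter leaves the former. -/
theorem coset_bracket (hmod : IsSuperModule ρ) (hμ : μ ≠ 0)
    (h : IsCliffordModule (fermion ρ μ)) (x y : Vir) (v : M) :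
    coset ρ h (Vir.bracket x y) v =
      coset ρ h x (coset ρ h y v) - coset ρ h y (coset ρ h x v) := by
  have hcomm : ∀ x k v, coset ρ h x (h.vira k v) = h.vira k (coset ρ h x v) := fun x =>
    h.map_vira h (coset ρ h x) 1 (one_mul 1) fun n v => by
      rw [one_smul, coset_fermion hmod hμ]
  induction x using Vir.induction_on with
  | zero => simp
  | add x x' hx hx' =>
    simp only [map_add, LinearMap.add_apply, hx, hx']
    abel
  | smul t x hx => simp only [map_smul, LinearMap.smul_apply, hx, smul_sub]
  | basis a =>
    induction y using Vir.induction_on with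
    | zero => simp
    | add y y' hy hy' =>
      simp only [map_add, LinearMap.add_apply, hy, hy']
      abel
    | smul t y hy => simp only [map_smul, LinearMap.smul_apply, hy, smul_sub]
    | basis b =>
      rw [Vir.bracket_basis]
      rcases a with m | _
      · rcases b with n | _
        · have hb := act_bracketBasis hmod (.L m) (.L n) v
          have hL : ∀ k v, ρ (basis (.L k)) v = coset ρ h (Vir.basis (.L k)) v + h.vira k v :=
            fun k v => by rw [coset_L, sub_add_cancel]
          have hc : ρ (basis .c) v = coset ρ h (Vir.basis .c) v + (1 / 2 : ℂ) • v := by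
            rw [coset_c, sub_add_cancel]
          simp only [bracketBasis, indexParity, ZMod.val_zero, zero_mul, pow_zero, one_smul,
            map_smul, map_add, LinearMap.add_apply, LinearMap.smul_apply, hL, hc, hcomm,
            h.vira_vira m n] at hb
          rw [← sub_eq_zero] at hb
          simp only [Vir.bracketBasis, map_smul, map_add, LinearMap.add_apply,
            LinearMap.smul_apply]
          rw [← sub_eq_zero, ← hb]
          split_ifs <;> module
        · have hb : ∀ v, ρ (basis (.L m)) (ρ (basis .c) v) = ρ (basis .c) (ρ (basis (.L m)) v) :=
            fun v => by
              have := act_bracketBasis hmod (.L m) .c v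
              simp only [bracketBasis, indexParity, ZMod.val_zero, zero_mul, pow_zero, one_smul,
                map_zero, LinearMap.zero_apply] at this
              exact sub_eq_zero.1 this.symm
          have hm := hcomm (Vir.basis .c) m v
          simp only [Vir.bracketBasis, map_zero, LinearMap.zero_apply]
          rw [coset_L, coset_L, map_sub, hm, coset_c, coset_c, map_sub, map_sub, map_smul,
            map_smul, hb]
          abel
      · rcases b with n | _
        · have hb : ∀ v, ρ (basis (.L n)) (ρ (basis .c) v) = ρ (basis .c) (ρ (basis (.L n)) v) :=
            fun v => by
              have := act_bracketBasis hmod (.L n) .c v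
              simp only [bracketBasis, indexParity, ZMod.val_zero, zero_mul, pow_zero, one_smul,
                map_zero, LinearMap.zero_apply] at this
              exact sub_eq_zero.1 this.symm
          have hm := hcomm (Vir.basis .c) n v
          simp only [Vir.bracketBasis, map_zero, LinearMap.zero_apply]
          rw [coset_L, coset_L, map_sub, hm, coset_c, coset_c, map_sub, map_sub, map_smul,
            map_smul, hb]
          abel
        · simp [Vir.bracketBasis]

/-- The action on what is created from a vacuum vector. -/
theorem act_creator (hmod : IsSuperModule ρ) (hμ : μ ≠ 0) (hlevel : HasLevel ρ (μ ^ 2))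
    (h : IsCliffordModule (fermion ρ μ)) {v : M} (hv : ∀ n : ℤ, 0 < n → fermion ρ μ n v = 0)
    (a : FVIndex) (x : Fock) :
    ρ (basis a) (Fock.creator h x v) = Fock.creator h (Fock.twistedAction μ (basis a) x) v +
      Fock.creator h x (coset ρ h (toVir (basis a)) v) := by
  have hcomm := fun y => Fock.map_creator h (coset ρ h y) (coset_fermion hmod hμ h y) x v
  rcases a with k | n | _ | _
  -- Creation from the vacuum vector `v` is a map of Clifford modules, so it carries `Lbar k` to
  -- `vira k`; the remainder of `L_k` is the coset operator, which passes through the creator.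
  · have e := Fock.isCliffordModule.map_vira h ((Fock.creator h).flip v) 1 (one_mul 1)
      (fun n y => by rw [one_smul]; exact Fock.creator_ψ h hv n y) k x
    simp only [LinearMap.flip_apply] at e
    rw [Fock.twistedAction_L, Fock.Lbar_eq_vira, e, toVir, Module.Basis.constr_basis, ← hcomm,
      coset_L, add_sub_cancel]
  · rw [Fock.twistedAction_ψ, LinearMap.smul_apply, map_smul, LinearMap.smul_apply,
      Fock.creator_ψ h hv, toVir, Module.Basis.constr_basis, map_zero, LinearMap.zero_apply,
      map_zero, add_zero, ψ_eq_smul_fermion hμ]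
  · rw [Fock.twistedAction_c, toVir, Module.Basis.constr_basis, ← hcomm, coset_c]
    simp
  · rw [Fock.twistedAction_z, toVir, Module.Basis.constr_basis, map_zero, LinearMap.zero_apply,
      map_zero, add_zero, hlevel]
    simp

end Coset

end FermionVirasoro

/-! ### The even vacuum vectors as a simple smooth Virasoro module -/

namespace FermionVirasoro

/-- On a purely even inflated Virasoro module the sign of the tensor product action plays
no role. -/
theorem tensorAct_inflation {M V : Type*} [AddCommGroup M] [Module ℂ M] [SuperSpace M]
    [AddCommGroup V] [Module ℂ V] [LieRingModule Vir V] [LieModule ℂ Vir V]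
    (τ : FermionVirasoro →ₗ[ℂ] Module.End ℂ M) (a : FVIndex) (x : M) (w : PureEven V) :
    tensorAct τ (inflation V) (basis a) (x ⊗ₜ[ℂ] w) =
      τ (basis a) x ⊗ₜ[ℂ] w + x ⊗ₜ[ℂ] inflation V (basis a) w := by
  have h0 : ∀ n, inflation V (basis (.ψ n)) = 0 := fun n => by
    have ht : toVir (basis (.ψ n)) = 0 := by simp [toVir]
    refine LinearMap.ext fun w => (inflation_apply V _ w).trans ?_
    rw [ht]
    exact zero_lie (L := Vir) (M := V) w
  rcases a with m | n | _ | _ <;>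
    simp [tensorAct, proj, parity_basis, indexParity, ZMod.val_one, h0, ← two_smul ℂ, smul_smul]

section Vacuum

variable {M : Type*} [AddCommGroup M] [Module ℂ M] [SuperSpace M]

/-- The even vacuum vectors. -/
def evenVacuum (Ψ : ℤ → Module.End ℂ M) : Submodule ℂ M where
  carrier := {v | parity v = v ∧ ∀ n : ℤ, 0 < n → Ψ n v = 0}
  add_mem' := fun {v w} hv hw =>
    ⟨by rw [map_add, hv.1, hw.1], fun n hn => by rw [map_add, hv.2 n hn, hw.2 n hn, add_zero]⟩
  zero_mem' := ⟨map_zero _, fun _ _ => map_zero _⟩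
  smul_mem' := fun t v hv =>
    ⟨by rw [map_smul, hv.1], fun n hn => by rw [map_smul, hv.2 n hn, smul_zero]⟩

variable {ρ : FermionVirasoro →ₗ[ℂ] Module.End ℂ M} {μ : ℂ}

theorem coset_mem_evenVacuum (hmod : IsSuperModule ρ) (hμ : μ ≠ 0)
    (h : IsCliffordModule (fermion ρ μ)) (x : Vir) {v : M} (hv : v ∈ evenVacuum (fermion ρ μ)) :
    coset ρ h x v ∈ evenVacuum (fermion ρ μ) :=
  ⟨by rw [parity_coset hmod, hv.1], fun n hn => by
    rw [← coset_fermion hmod hμ, hv.2 n hn, map_zero]⟩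

/-- The coset Virasoro action on the even vacuum vectors. -/
abbrev evenVacuumLieRingModule (hmod : IsSuperModule ρ) (hμ : μ ≠ 0)
    (h : IsCliffordModule (fermion ρ μ)) : LieRingModule Vir (evenVacuum (fermion ρ μ)) where
  bracket x v := ⟨coset ρ h x v, coset_mem_evenVacuum hmod hμ h x v.2⟩
  add_lie x y v := Subtype.ext (by simp)
  lie_add x v w := Subtype.ext (by simp)
  leibniz_lie x y v := Subtype.ext (by
    change coset ρ h x (coset ρ h y v) =
      coset ρ h (Vir.bracket x y) v + coset ρ h y (coset ρ h x v)
    rw [coset_bracket hmod hμ, sub_add_cancel])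

theorem evenVacuumLieModule (hmod : IsSuperModule ρ) (hμ : μ ≠ 0)
    (h : IsCliffordModule (fermion ρ μ)) :
    letI := evenVacuumLieRingModule hmod hμ h
    LieModule ℂ Vir (evenVacuum (fermion ρ μ)) :=
  letI := evenVacuumLieRingModule hmod hμ h
  { smul_lie := fun t x v => Subtype.ext (by
      change coset ρ h (t • x) v = t • coset ρ h x v
      rw [map_smul, LinearMap.smul_apply])
    lie_smul := fun t x v => Subtype.ext (by
      change coset ρ h x (t • (v : M)) = t • coset ρ h x v
      rw [map_smul]) }

/-- The coset action on the even vacuum vectors is smooth. -/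
theorem exists_forall_coset_eq_zero (hsmooth : IsSmooth component ρ)
    (h : IsCliffordModule (fermion ρ μ)) {v : M} (hv : v ∈ evenVacuum (fermion ρ μ)) :
    ∃ n : ℕ, ∀ i : ℤ, (n : ℤ) < i → ∀ x ∈ Vir.component i, coset ρ h x v = 0 := by
  obtain ⟨n, hn⟩ := hsmooth v
  refine ⟨n, fun i hi x hx => ?_⟩
  induction hx using Submodule.span_induction with
  | zero => simp
  | add x y _ _ hx hy => rw [map_add, LinearMap.add_apply, hx, hy, add_zero]
  | smul t x _ hx => rw [map_smul, LinearMap.smul_apply, hx, smul_zero]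
  | mem x hx =>
    obtain ⟨a, ha, rfl⟩ := hx
    rcases a with k | _
    · obtain rfl : k = i := ha
      -- On a vacuum vector the fermionic part vanishes in positive degree, so the bound for the
      -- given action serves again.
      rw [coset_L, hn k hi _ (Submodule.subset_span ⟨.L k, rfl, rfl⟩),
        h.vira_vacuum hv.2 (by omega), sub_zero]
    · have : (0 : ℤ) = i := ha
      omega

/-- If the module `M` is simple, the even vacuum vectors have no nontrivial subspace stable under
the coset action. -/
theorem eq_evenVacuum_of_stable (hmod : IsSuperModule ρ) (hsimple : IsSimpleSuperModule ρ)
    (hμ : μ ≠ 0) (hlevel : HasLevel ρ (μ ^ 2)) (h : IsCliffordModule (fermion ρ μ))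
    (U : Submodule ℂ (evenVacuum (fermion ρ μ)))
    (hU : ∀ x, ∀ u ∈ U, ∀ hu : coset ρ h x u ∈ evenVacuum (fermion ρ μ),
      (⟨_, hu⟩ : evenVacuum _) ∈ U)
    (hne : U ≠ ⊥) : U = ⊤ := by
  let i : U →ₗ[ℂ] M := (evenVacuum (fermion ρ μ)).subtype ∘ₗ U.subtype
  have hi : ∀ u : U, i u ∈ evenVacuum (fermion ρ μ) := fun u => u.1.2
  have hpar : ∀ v ∈ LinearMap.range (Fock.fromFock h i),
      parity v ∈ LinearMap.range (Fock.fromFock h i) := by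
    rintro _ ⟨t, rfl⟩
    induction t with
    | zero => simp
    | tmul x u =>
      refine ⟨parity x ⊗ₜ u, ?_⟩
      rw [Fock.fromFock_tmul, Fock.fromFock_tmul, ← Fock.creator_parity h (parity_fermion hmod),
        (hi u).1]
    | add s t hs ht => rw [map_add, map_add]; exact add_mem hs ht
  have hact : ∀ y, ∀ v ∈ LinearMap.range (Fock.fromFock h i),
      ρ y v ∈ LinearMap.range (Fock.fromFock h i) := by
    rintro y _ ⟨t, rfl⟩
    have hy : y ∈ Submodule.span ℂ (Set.range basis) := by
      rw [basis.span_eq]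
      exact Submodule.mem_top
    induction hy using Submodule.span_induction with
    | zero => simp
    | add y z _ _ hy hz => rw [map_add, LinearMap.add_apply]; exact add_mem hy hz
    | smul s y _ hy => rw [map_smul, LinearMap.smul_apply]; exact Submodule.smul_mem _ _ hy
    | mem y hy =>
      obtain ⟨a, rfl⟩ := hy
      induction t with
      | zero => simp
      | tmul x u =>
        have hm := coset_mem_evenVacuum hmod hμ h (toVir (basis a)) (hi u)
        refine ⟨Fock.twistedAction μ (basis a) x ⊗ₜ u + x ⊗ₜ ⟨⟨_, hm⟩, hU _ u u.2 hm⟩, ?_⟩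
        rw [map_add, Fock.fromFock_tmul, Fock.fromFock_tmul, Fock.fromFock_tmul,
          act_creator hmod hμ hlevel h (hi u).2]
        rfl
      | add s t hs ht => rw [map_add, map_add]; exact add_mem hs ht
  -- The range is the image of Fock ⊗ `U`. It contains `U` itself, as the image of `1 ⊗ U`, so it is
  -- not zero.
  rcases hsimple.eq_bot_or_eq_top (LinearMap.range (Fock.fromFock h i)) hpar hact with hW | hW
  · refine absurd ((Submodule.eq_bot_iff _).2 fun u hu => ?_) hne
    have hmem : Fock.fromFock h i (1 ⊗ₜ ⟨u, hu⟩) ∈ LinearMap.range (Fock.fromFock h i) := ⟨_, rfl⟩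
    rw [hW, Submodule.mem_bot, Fock.fromFock_tmul, Fock.creator_one] at hmem
    exact Subtype.ext hmem
  · refine Submodule.eq_top_iff'.2 fun v => ?_
    obtain ⟨t, ht⟩ := LinearMap.range_eq_top.1 hW v
    have hinj := Fock.fromFock_injective h (parity_fermion hmod)
      (i := (evenVacuum (fermion ρ μ)).subtype) Subtype.val_injective (fun w => w.2.2)
      (fun w => w.2.1)
    have e : ∀ t, Fock.fromFock h i t =
        Fock.fromFock h (evenVacuum (fermion ρ μ)).subtype (U.subtype.lTensor Fock t) := by
      intro t
      induction t with
      | zero => simp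
      | tmul x u => simp only [LinearMap.lTensor_tmul, Fock.fromFock_tmul]; rfl
      | add s t hs ht => simp only [map_add, hs, ht]
    -- Injectivity on the full Fock ⊗ `V` lifts the equality in `M` to the tensor product; taking
    -- the vacuum coefficient then shows that `v` lies in `U`.
    have ht' : U.subtype.lTensor Fock t = 1 ⊗ₜ v := hinj (by
      rw [← e, ht, Fock.fromFock_tmul, Fock.creator_one]
      rfl)
    have hv : v = U.subtype (TensorProduct.lid ℂ U (Fock.vacuumCoeff.rTensor U t)) := by
      have e' : ∀ t, TensorProduct.lid ℂ _ (Fock.vacuumCoeff.rTensor _ (U.subtype.lTensor Fock t)) =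
          U.subtype (TensorProduct.lid ℂ U (Fock.vacuumCoeff.rTensor U t)) := by
        intro t
        induction t with
        | zero => simp
        | tmul x u => simp
        | add s t hs ht => simp only [map_add, hs, ht]
      rw [← e', ht', LinearMap.rTensor_tmul, Fock.vacuumCoeff_one, TensorProduct.lid_tmul, one_smul]
    rw [hv]
    exact Subtype.prop _

end Vacuum

end FermionVirasoro

end

/-! ### The decomposition theorem -/

theorem theorem4p3 {M : Type u} [AddCommGroup M] [Module ℂ M] [SuperSpace M]
    (ρ : FermionVirasoro →ₗ[ℂ] Module.End ℂ M) (hmod : IsSuperModule ρ)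
    (hsimple : IsSimpleSuperModule ρ) (hsmooth : IsSmooth FermionVirasoro.component ρ)
    (ℓ : ℂ) (hℓ : ℓ ≠ 0) (hlevel : FermionVirasoro.HasLevel ρ ℓ) :
    ∃ (V : Type u) (_ : AddCommGroup V) (_ : Module ℂ V) (_ : LieRingModule Vir V)
      (_ : LieModule ℂ Vir V) (μ : ℂ),
      LieModule.IsIrreducible ℂ Vir V ∧
      IsSmooth Vir.component (virAction V) ∧
      μ ^ 2 = ℓ ∧
      IsSuperModule (Fock.twistedAction μ) ∧
      SuperIso ρ (tensorAct (Fock.twistedAction μ) (inflation V)) := by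
  -- Either square root will do: the construction uses only `μ ^ 2 = ℓ` and `μ ≠ 0`.
  obtain ⟨μ, rfl⟩ := IsAlgClosed.exists_pow_nat_eq ℓ (n := 2) two_pos
  have hμ : μ ≠ 0 := fun h0 => hℓ (by rw [h0]; norm_num)
  have h := FermionVirasoro.isCliffordModule_fermion hmod hsmooth hμ hlevel
  let _ := FermionVirasoro.evenVacuumLieRingModule hmod hμ h
  have := FermionVirasoro.evenVacuumLieModule hmod hμ h
  let i : PureEven (FermionVirasoro.evenVacuum (FermionVirasoro.fermion ρ μ)) →ₗ[ℂ] M :=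
    (FermionVirasoro.evenVacuum (FermionVirasoro.fermion ρ μ)).subtype
  have hi : ∀ w, i w ∈ FermionVirasoro.evenVacuum (FermionVirasoro.fermion ρ μ) :=
    fun w => Subtype.prop (p := (· ∈ FermionVirasoro.evenVacuum (FermionVirasoro.fermion ρ μ))) w
  have hinj : Function.Injective (Fock.fromFock h i) :=
    Fock.fromFock_injective h (FermionVirasoro.parity_fermion hmod) Subtype.val_injective
      (fun w => (hi w).2) (fun w => (hi w).1)
  have hsurj : Function.Surjective (Fock.fromFock h i) :=
    Fock.fromFock_surjective h (FermionVirasoro.parity_fermion hmod) (fun w => (hi w).2)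
      (fun v h0 h1 =>
        ⟨(⟨v, h0, h1⟩ : FermionVirasoro.evenVacuum (FermionVirasoro.fermion ρ μ)), rfl⟩)
  refine ⟨FermionVirasoro.evenVacuum (FermionVirasoro.fermion ρ μ), inferInstance, inferInstance,
    inferInstance, inferInstance, μ, ?_, fun v =>
      (FermionVirasoro.exists_forall_coset_eq_zero hsmooth h v.2).imp fun n hn j hj x hx =>
        Subtype.ext (hn j hj x hx), rfl, Fock.isSuperModule_twistedAction μ, ?_⟩
  -- Without even vacuum vectors Fock ⊗ `V` would be zero, yet it maps onto the nonzero `M`.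
  · have : Nontrivial (FermionVirasoro.evenVacuum (FermionVirasoro.fermion ρ μ)) := by
      by_contra hn
      rw [not_nontrivial_iff_subsingleton] at hn
      have := hsimple.nontrivial
      obtain ⟨v, hv⟩ := exists_ne (0 : M)
      obtain ⟨t, rfl⟩ := hsurj v
      refine hv ?_
      clear hv
      induction t with
      | zero => simp
      | tmul x w =>
        have hw : i w = 0 := congrArg Subtype.val
          (Subsingleton.elim (α := FermionVirasoro.evenVacuum (FermionVirasoro.fermion ρ μ)) w 0)
        rw [Fock.fromFock_tmul, hw, map_zero]
      | add s t hs ht => rw [map_add, hs, ht, add_zero]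
    refine LieModule.IsIrreducible.mk fun U hU => ?_
    rw [← LieSubmodule.toSubmodule_eq_top]
    refine FermionVirasoro.eq_evenVacuum_of_stable hmod hsimple hμ hlevel h _
      (fun x u hu hx => U.lie_mem hu) fun hb => hU ?_
    rwa [LieSubmodule.toSubmodule_eq_bot] at hb
  · let e := LinearEquiv.ofBijective (Fock.fromFock h i) ⟨hinj, hsurj⟩
    have hparity : ∀ t, e (SuperSpace.parity t) = SuperSpace.parity (e t) := by
      intro t
      induction t with
      | zero => simp
      | tmul x w =>
        change Fock.fromFock h i (SuperSpace.parity x ⊗ₜ w) =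
          SuperSpace.parity (Fock.fromFock h i (x ⊗ₜ w))
        rw [Fock.fromFock_tmul, Fock.fromFock_tmul,
          ← Fock.creator_parity h (FermionVirasoro.parity_fermion hmod), (hi w).1]
      | add s t hs ht => simp only [map_add, hs, ht]
    have hact : ∀ x t, e (tensorAct (Fock.twistedAction μ)
        (inflation (FermionVirasoro.evenVacuum (FermionVirasoro.fermion ρ μ))) x t) =
        ρ x (e t) := by
      intro y t
      have hy : y ∈ Submodule.span ℂ (Set.range FermionVirasoro.basis) := by
        rw [FermionVirasoro.basis.span_eq]
        exact Submodule.mem_top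
      induction hy using Submodule.span_induction with
      | zero => simp
      | add y z _ _ hy hz => simp only [map_add, LinearMap.add_apply, hy, hz]
      | smul s y _ hy => simp only [map_smul, LinearMap.smul_apply, hy]
      | mem y hy =>
        obtain ⟨a, rfl⟩ := hy
        induction t with
        | zero => simp
        | tmul x w =>
          rw [FermionVirasoro.tensorAct_inflation, map_add]
          change Fock.fromFock h i _ + Fock.fromFock h i _ = ρ _ (Fock.fromFock h i _)
          rw [Fock.fromFock_tmul, Fock.fromFock_tmul, Fock.fromFock_tmul,
            FermionVirasoro.act_creator hmod hμ hlevel h (hi w).2]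
          rfl
        | add s t hs ht => simp only [map_add, hs, ht]
    refine ⟨e.symm, fun v => ?_, fun x v => ?_⟩
    · rw [LinearEquiv.symm_apply_eq, hparity, LinearEquiv.apply_symm_apply]
    · rw [LinearEquiv.symm_apply_eq, hact, LinearEquiv.apply_symm_apply]
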